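/- Let $n\ge 2$. Permutations in $\mathbb S_n$ are multiplied from left to right ($ab$ means first $a$, then $b$), $\varepsilon$ is the identity and $\omega$ is the permutation $i\mapsto n+1-i$. For $a\in\mathbb S_n$ put $\mathrm{Inv}(a)=\{(i,j): i<j,\ a(i)>a(j)\}$. Order $\mathbb S_n$ by inclusion of the sets $\mathrm{Inv}(a)$; this is a lattice order, with meet $\wedge$. For $a,b\in\mathbb S_n$ define $$a\asymp b = a\,(a^{-1}\wedge b\omega),\qquad a\bowtie b=(a^{-1}\wedge b\omega)^{-1}\,b,\qquad \widetilde a=\omega a\omega .$$ Let $\mathbf{Br}_n=\langle \sigma_1,\dots,\sigma_{n-1}\mid \sigma_i\sigma_j=\sigma_j\sigma_i\ (|i-j|>1),\ \sigma_i\sigma_{i+1}\sigma_i=\sigma_{i+1}\sigma_i\sigma_{i+1}\rangle$ be the braid group. For $a\in\mathbb S_n$ let $R_a\in\mathbf{Br}_n$ be the non-repeating braid with permutation $a$, that is, the element represented by a positive word in the $\sigma_i$ whose permutation is $a$ and in which any two strands cross at most once. Put $\widetilde{R_a}=R_{\widetilde a}$ (this is the image of $R_a$ under the flip $\sigma_i\mapsto\sigma_{n-i}$)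 and $\Omega=R_\omega$. Let $X=\{R_a : a\in\mathbb S_n,\ a\ne\varepsilon\}\cup\{\Omega^{-1}\}$ be regarded as an alphabet, where $R_\varepsilon$ denotes the empty word. Order the letters as follows: $R_a\prec R_b$ if $|\mathrm{Inv}(a)|<|\mathrm{Inv}(b)|$, or if $|\mathrm{Inv}(a)|=|\mathrm{Inv}(b)|$ and the list of the pairs of $\mathrm{Inv}(a)$ in lexicographic order is lexicographically smaller than that of $\mathrm{Inv}(b)$; and $R_a\prec\Omega^{-1}$ for all $a$. Extend $\preceq$ degree-lexicographically (length first, then lexicographically) to the words in $X$. Theorem. The relations $$R_aR_b=R_{a\asymp b}R_{a\bowtie b},\qquad \Omega^{-1}R_a=\widetilde{R_a}\,\Omega^{-1},\qquad \Omega\Omega^{-1}=\Omega^{-1}\Omega=R_\varepsilon\qquad(a,b\in\mathbb S_n)$$ form a Gröbner–Shirshov basis of $\mathbf{Br}_n$ in the generators $X$ with respect to $\preceq$. That is: $X$ generates $\mathbf{Br}_n$ as a monoid and the relations are defining relations of $\mathbf{Br}_n$ as a monoid generated by $X$; and, for every field $k$, $\preceq$ is a monomial well-order and the set $S$ of the elements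 $u-v\in k\langle X\rangle$, where $u=v$ runs over the above relations whose two sides are different words, consists of monic polynomials and all compositions (of intersection and of inclusion) of its elements are trivial. Here, for $f,g\in S$ with leading words $\bar f,\bar g$, the compositions are $fb-ag$ for words $a,b$ with $w=\bar f b=a\bar g$ of length less than $|\bar f|+|\bar g|$, and $f-agb$ for words $a,b$ with $w=\bar f=a\bar g b$; a composition is trivial if it is a $k$-linear combination of elements $asb$ with $s\in S$, words $a,b$ and $a\bar s b\prec w$. -/

import Mathlib

namespace BraidGS

/-! ### Permutations, inversion sets and the lattice order -/

section Permutations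

variable {n : ℕ}

/-- The product `ab` of permutations in the left-to-right convention: first `a`, then `b`. -/
def pmul (a b : Equiv.Perm (Fin n)) : Equiv.Perm (Fin n) := a.trans b

/-- The order-reversing permutation `ω`. -/
def omega (n : ℕ) : Equiv.Perm (Fin n) := Fin.revPerm

/-- `R_π` as a set of pairs: all `(i, j)` with `i < j` and `π i > π j`. -/
def inversions (a : Equiv.Perm (Fin n)) : Finset (Fin n × Fin n) :=
  Finset.univ.filter fun p => p.1 < p.2 ∧ a p.2 < a p.1

theorem mem_inversions (a : Equiv.Perm (Fin n)) (i j : Fin n) :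
    (i, j) ∈ inversions a ↔ i < j ∧ a j < a i := by
  simp [inversions]

/-- The partial order on permutations given by inclusion of inversion sets. -/
def PermLE (a b : Equiv.Perm (Fin n)) : Prop := inversions a ⊆ inversions b

/-- `x` is the greatest lower bound of `a` and `b` for `PermLE`. -/
def IsMeet (a b x : Equiv.Perm (Fin n)) : Prop :=
  PermLE x a ∧ PermLE x b ∧ ∀ y, PermLE y a → PermLE y b → PermLE y x

/-- A strict total order on `Fin n` is realised by a permutation. -/
theorem exists_perm_of_order (r : Fin n → Fin n → Prop) (hirr : ∀ i, ¬ r i i)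
    (htr : ∀ i j k, r i j → r j k → r i k) (htot : ∀ i j, i ≠ j → r i j ∨ r j i) :
    ∃ x : Equiv.Perm (Fin n), ∀ i j, x i < x j ↔ r i j := by
  classical
  let f : Fin n → ℕ := fun i => (Finset.univ.filter fun j => r j i).card
  have hlt : ∀ i j, r i j → f i < f j := by
    intro i j hij
    apply Finset.card_lt_card
    refine (Finset.ssubset_iff_of_subset ?_).2 ⟨i, by simpa using hij, by simpa using hirr i⟩
    intro k hk
    simp only [Finset.mem_filter, Finset.mem_univ, true_and] at hk ⊢
    exact htr _ _ _ hk hij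
  have hb : ∀ i, f i < n := by
    intro i
    have h : f i < (Finset.univ : Finset (Fin n)).card := by
      apply Finset.card_lt_card
      exact (Finset.ssubset_iff_of_subset (Finset.subset_univ _)).2
        ⟨i, Finset.mem_univ _, by simpa using hirr i⟩
    simpa using h
  let g : Fin n → Fin n := fun i => ⟨f i, hb i⟩
  have hg : ∀ i j, g i < g j ↔ r i j := by
    intro i j
    constructor
    · intro h
      by_contra hn
      rcases eq_or_ne i j with rfl | hne
      · exact lt_irrefl _ h
      · exact lt_asymm h (hlt _ _ ((htot i j hne).resolve_left hn))
    · exact hlt i j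
  have hinj : Function.Injective g := by
    intro i j h
    by_contra hne
    rcases htot i j hne with h' | h'
    · exact absurd h ((hg i j).2 h').ne
    · exact absurd h ((hg j i).2 h').ne'
  exact ⟨Equiv.ofBijective g (Finite.injective_iff_bijective.1 hinj), hg⟩

theorem exists_meet (a b : Equiv.Perm (Fin n)) : ∃ x, IsMeet a b x := by
  let N : Fin n → Fin n → Prop := fun i j => i < j ∧ (a i < a j ∨ b i < b j)
  let T : Fin n → Fin n → Prop := Relation.TransGen N
  have hTlt : ∀ i j, T i j → i < j := by
    intro i j h
    induction h with
    | single h => exact h.1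
    | tail _ h ih => exact ih.trans h.1
  have hN : ∀ i j k, i < j → j < k → N i k → N i j ∨ N j k := by
    intro i j k hij hjk h
    rcases h.2 with h' | h'
    · rcases lt_or_ge (a i) (a j) with h1 | h1
      · exact Or.inl ⟨hij, Or.inl h1⟩
      · exact Or.inr ⟨hjk, Or.inl (h1.trans_lt h')⟩
    · rcases lt_or_ge (b i) (b j) with h1 | h1
      · exact Or.inl ⟨hij, Or.inr h1⟩
      · exact Or.inr ⟨hjk, Or.inr (h1.trans_lt h')⟩
  have hsplit : ∀ i k, T i k → ∀ j, i < j → j < k → T i j ∨ T j k := by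
    intro i k h
    induction h with
    | single h =>
      intro j hij hjk
      exact (hN _ _ _ hij hjk h).imp Relation.TransGen.single Relation.TransGen.single
    | @tail c k hic hck ih =>
      intro j hij hjk
      rcases lt_trichotomy j c with h | h | h
      · exact (ih j hij h).imp id fun h' => h'.tail hck
      · subst h
        exact Or.inl hic
      · rcases hN _ _ _ h hjk hck with h' | h'
        · exact Or.inl (hic.tail h')
        · exact Or.inr (Relation.TransGen.single h')
  obtain ⟨x, hx⟩ := exists_perm_of_order (fun i j => T i j ∨ (j < i ∧ ¬ T j i))
    (by
      rintro i (h | h)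
      · exact lt_irrefl _ (hTlt _ _ h)
      · exact lt_irrefl _ h.1)
    (by
      rintro i j k (hij | ⟨hij, hij'⟩) (hjk | ⟨hjk, hjk'⟩)
      · exact Or.inl (hij.trans hjk)
      · rcases lt_trichotomy i k with h | h | h
        · exact Or.inl ((hsplit _ _ hij k h hjk).resolve_right hjk')
        · subst h
          exact absurd hij hjk'
        · exact Or.inr ⟨h, fun h' => hjk' (h'.trans hij)⟩
      · rcases lt_trichotomy i k with h | h | h
        · exact Or.inl ((hsplit _ _ hjk i hij h).resolve_left hij')
        · subst h
          exact absurd hjk hij'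
        · exact Or.inr ⟨h, fun h' => hij' (hjk.trans h')⟩
      · refine Or.inr ⟨hjk.trans hij, fun h => ?_⟩
        rcases hsplit _ _ h j hjk hij with h' | h'
        · exact hjk' h'
        · exact hij' h')
    (by
      intro i j hne
      by_cases h1 : T i j
      · exact Or.inl (Or.inl h1)
      by_cases h2 : T j i
      · exact Or.inr (Or.inl h2)
      rcases lt_or_gt_of_ne hne with h | h
      · exact Or.inr (Or.inr ⟨h, h1⟩)
      · exact Or.inl (Or.inr ⟨h, h2⟩))
  have key : ∀ i j, (i, j) ∈ inversions x → i < j ∧ ¬ N i j := by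
    intro i j h
    rw [mem_inversions, hx] at h
    refine ⟨h.1, fun h' => ?_⟩
    rcases h.2 with h2 | h2
    · exact lt_asymm h.1 (hTlt _ _ h2)
    · exact h2.2 (Relation.TransGen.single h')
  refine ⟨x, ?_, ?_, ?_⟩
  · rintro ⟨i, j⟩ h
    obtain ⟨hij, h'⟩ := key i j h
    rw [mem_inversions]
    refine ⟨hij, lt_of_le_of_ne (not_lt.1 fun h2 => h' ⟨hij, Or.inl h2⟩) ?_⟩
    exact fun h3 => hij.ne' (a.injective h3)
  · rintro ⟨i, j⟩ h
    obtain ⟨hij, h'⟩ := key i j h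
    rw [mem_inversions]
    refine ⟨hij, lt_of_le_of_ne (not_lt.1 fun h2 => h' ⟨hij, Or.inr h2⟩) ?_⟩
    exact fun h3 => hij.ne' (b.injective h3)
  · rintro y ha hb ⟨i, j⟩ h
    rw [mem_inversions] at h
    have hy : ∀ i j, T i j → y i < y j := by
      intro i j hT
      have hNy : ∀ i j, N i j → y i < y j := by
        intro i j hij
        by_contra hlt
        have hlt' : y j < y i :=
          lt_of_le_of_ne (not_lt.1 hlt) fun h3 => hij.1.ne' (y.injective h3)
        have h1 := (mem_inversions a i j).1 (ha ((mem_inversions y i j).2 ⟨hij.1, hlt'⟩))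
        have h2 := (mem_inversions b i j).1 (hb ((mem_inversions y i j).2 ⟨hij.1, hlt'⟩))
        rcases hij.2 with h3 | h3
        · exact lt_asymm h3 h1.2
        · exact lt_asymm h3 h2.2
      induction hT with
      | single h => exact hNy _ _ h
      | tail _ h ih => exact ih.trans (hNy _ _ h)
    rw [mem_inversions, hx]
    exact ⟨h.1, Or.inr ⟨h.1, fun hT => lt_asymm h.2 (hy _ _ hT)⟩⟩

/-- The lattice meet `a ∧ b`. -/
noncomputable def meet (a b : Equiv.Perm (Fin n)) : Equiv.Perm (Fin n) :=
  (exists_meet a b).choose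

theorem meet_spec (a b : Equiv.Perm (Fin n)) : IsMeet a b (meet a b) :=
  (exists_meet a b).choose_spec

/-- The complement `¬ b = b ω`; its inversion set is the complement of that of `b`. -/
def compl (b : Equiv.Perm (Fin n)) : Equiv.Perm (Fin n) := pmul b (omega n)

/-- `a ≍ b = a (a⁻¹ ∧ ¬b)`. -/
noncomputable def give (a b : Equiv.Perm (Fin n)) : Equiv.Perm (Fin n) :=
  pmul a (meet a⁻¹ (compl b))

/-- `a ⋈ b = (a⁻¹ ∧ ¬b)⁻¹ b`. -/
noncomputable def take (a b : Equiv.Perm (Fin n)) : Equiv.Perm (Fin n) :=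
  pmul (meet a⁻¹ (compl b))⁻¹ b

/-- The flip on permutations: conjugation by `ω`, i.e. the automorphism of the symmetric group
with `(i, i+1) ↦ (n-i, n-i+1)` in one-based numbering, see `flip_pmul` and `flip_swap`. -/
def flip (a : Equiv.Perm (Fin n)) : Equiv.Perm (Fin n) := pmul (omega n) (pmul a (omega n))

theorem flip_pmul (a b : Equiv.Perm (Fin n)) : flip (pmul a b) = pmul (flip a) (flip b) := by
  ext i
  simp [flip, pmul, omega]

theorem flip_swap (i j : Fin n) : flip (Equiv.swap i j) = Equiv.swap i.rev j.rev := by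
  ext k
  simp only [flip, pmul, omega, Equiv.trans_apply, Fin.revPerm_apply, Equiv.swap_apply_def,
    Fin.rev_eq_iff]
  split_ifs <;> simp_all

end Permutations

/-! ### The braid group and its non-repeating braids -/

section Braids

variable {n : ℕ}

/-- The left one of the two positions at which the `i`-th generator acts. -/
def lo (i : Fin (n - 1)) : Fin n := ⟨i.1, by omega⟩

/-- The right one of the two positions at which the `i`-th generator acts. -/
def hi (i : Fin (n - 1)) : Fin n := ⟨i.1 + 1, by omega⟩

/-- The Artin relators. -/
def braidRels (n : ℕ) : Set (FreeGroup (Fin (n - 1))) :=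
  {r | ∃ i j : Fin (n - 1), i.1 + 1 < j.1 ∧
      r = (FreeGroup.of i * FreeGroup.of j) * (FreeGroup.of j * FreeGroup.of i)⁻¹} ∪
  {r | ∃ i j : Fin (n - 1), i.1 + 1 = j.1 ∧
      r = (FreeGroup.of i * FreeGroup.of j * FreeGroup.of i) *
        (FreeGroup.of j * FreeGroup.of i * FreeGroup.of j)⁻¹}

/-- The braid group on `n` strands. -/
abbrev BraidGroup (n : ℕ) : Type := PresentedGroup (braidRels n)

/-- The braid of a word in the positive crossings `σ_i`. -/
def braidOf (w : List (Fin (n - 1))) : BraidGroup n :=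
  (w.map fun i => (PresentedGroup.of i : BraidGroup n)).prod

/-- The permutation of a positive braid word: it sends the top endpoint of each strand to its
bottom endpoint. -/
def wordPerm : List (Fin (n - 1)) → Equiv.Perm (Fin n)
  | [] => 1
  | i :: w => pmul (Equiv.swap (lo i) (hi i)) (wordPerm w)

/-- The list of crossings of a positive braid word, from top to bottom; each crossing is recorded
as the unordered pair of its two strands, named by their top endpoints. -/
def crossings : List (Fin (n - 1)) → List (Sym2 (Fin n))
  | [] => []
  | i :: w => s(lo i, hi i) :: (crossings w).map (Sym2.map (Equiv.swap (lo i) (hi i)))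

/-- A positive word is non-repeating if any two strands cross at most once. -/
def NonRepeating (w : List (Fin (n - 1))) : Prop := (crossings w).Nodup

/-- `β` is a non-repeating braid with permutation `a`. -/
def IsThurstonBraid (a : Equiv.Perm (Fin n)) (β : BraidGroup n) : Prop :=
  ∃ w : List (Fin (n - 1)), NonRepeating w ∧ wordPerm w = a ∧ braidOf w = β

theorem exists_descent (a : Equiv.Perm (Fin n)) (ha : a ≠ 1) :
    ∃ i : Fin (n - 1), a (hi i) < a (lo i) := by
  by_contra hcon
  push Not at hcon
  apply ha
  have hmono : StrictMono a := by
    cases n with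
    | zero => intro i; exact i.elim0
    | succ m =>
      rw [Fin.strictMono_iff_lt_succ]
      intro i
      refine lt_of_le_of_ne (hcon i) fun h => ?_
      have := congrArg Fin.val (a.injective h)
      simp at this
  have h : a = 1 ↔ (hmono.orderIsoOfSurjective _ a.surjective) = OrderIso.refl _ := by
    constructor
    · intro _; exact Subsingleton.elim _ _
    · intro h
      ext i
      have := congrArg (fun e => (e i).val) h
      simpa using this
  exact h.2 (Subsingleton.elim _ _)

theorem swap_lt_swap (i : Fin (n - 1)) (x y : Fin n) (hxy : x < y)
    (hne : s(x, y) ≠ s(lo i, hi i)) :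
    Equiv.swap (lo i) (hi i) x < Equiv.swap (lo i) (hi i) y := by
  have h1 : ¬ (x = lo i ∧ y = hi i) := by
    rintro ⟨rfl, rfl⟩
    exact hne rfl
  simp only [Equiv.swap_apply_def, Fin.ext_iff, Fin.lt_def, lo, hi] at *
  split_ifs <;> (try dsimp only) <;> omega

theorem exists_nonRepeating_aux (m : ℕ) : ∀ a : Equiv.Perm (Fin n), (inversions a).card = m →
    ∃ w : List (Fin (n - 1)), NonRepeating w ∧ wordPerm w = a ∧
      ∀ x y, x < y → s(x, y) ∈ crossings w → a y < a x := by
  induction m using Nat.strong_induction_on with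
  | _ m ih =>
    intro a ham
    by_cases ha : a = 1
    · exact ⟨[], List.nodup_nil, ha.symm, by simp [crossings]⟩
    obtain ⟨i, hi'⟩ := exists_descent a ha
    have hlohi : lo i < hi i := by simp [lo, hi, Fin.lt_def]
    set s := Equiv.swap (lo i) (hi i) with hs
    have hss : ∀ x, s (s x) = x := fun x => by simp [hs]
    have hcard : (inversions (pmul s a)).card < m := by
      rw [← ham, ← Finset.card_image_of_injective (inversions (pmul s a))
        (s.injective.prodMap s.injective)]
      apply Finset.card_lt_card
      have hsub : ∀ x y, (x, y) ∈ inversions (pmul s a) →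
          s x < s y ∧ a (s y) < a (s x) ∧ s(x, y) ≠ s(lo i, hi i) := by
        intro x y h
        rw [mem_inversions] at h
        have hne : s(x, y) ≠ s(lo i, hi i) := by
          intro he
          rcases Sym2.eq_iff.1 he with ⟨rfl, rfl⟩ | ⟨rfl, rfl⟩
          · have h2 := h.2
            simp only [pmul, hs, Equiv.trans_apply, Equiv.swap_apply_left,
              Equiv.swap_apply_right] at h2
            exact lt_asymm h2 hi'
          · exact lt_asymm h.1 hlohi
        exact ⟨swap_lt_swap i x y h.1 hne, h.2, hne⟩
      refine (Finset.ssubset_iff_of_subset ?_).2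
        ⟨(lo i, hi i), (mem_inversions _ _ _).2 ⟨hlohi, hi'⟩, ?_⟩
      · intro p hp
        obtain ⟨⟨x, y⟩, hxy, rfl⟩ := Finset.mem_image.1 hp
        have := hsub x y hxy
        exact (mem_inversions _ _ _).2 ⟨this.1, this.2.1⟩
      · intro hp
        obtain ⟨⟨x, y⟩, hxy, he⟩ := Finset.mem_image.1 hp
        have h3 := (hsub x y hxy).2.2
        simp only [Prod.map_apply, Prod.mk.injEq] at he
        apply h3
        have hx : x = hi i := by rw [← hss x, he.1, hs, Equiv.swap_apply_left]
        have hy : y = lo i := by rw [← hss y, he.2, hs, Equiv.swap_apply_right]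
        rw [hx, hy, Sym2.eq_swap]
    obtain ⟨w, hw, hwa, hwc⟩ := ih _ hcard (pmul s a) rfl
    have hnot : s(lo i, hi i) ∉ crossings w := by
      intro hmem
      have h2 := hwc _ _ hlohi hmem
      simp only [pmul, hs, Equiv.trans_apply, Equiv.swap_apply_left,
        Equiv.swap_apply_right] at h2
      exact lt_asymm h2 hi'
    have hback : ∀ x y, s(x, y) ∈ (crossings w).map (Sym2.map s) →
        s(s x, s y) ∈ crossings w := by
      intro x y h
      obtain ⟨e, he, hexy⟩ := List.mem_map.1 h
      have : e = s(s x, s y) := by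
        rw [← Sym2.map_mk, ← hexy, Sym2.map_map]
        have : (s ∘ s : Fin n → Fin n) = id := funext hss
        rw [this, Sym2.map_id, id]
      rwa [← this]
    refine ⟨i :: w, ?_, ?_, ?_⟩
    · refine List.nodup_cons.2 ⟨fun h => ?_, hw.map (Sym2.map.injective s.injective)⟩
      have := hback _ _ h
      rw [hs, Equiv.swap_apply_left, Equiv.swap_apply_right, Sym2.eq_swap] at this
      exact hnot this
    · ext x
      simp only [wordPerm, hwa, pmul, Equiv.trans_apply]
      rw [← hs, hss]
    · intro x y hxy h
      rcases List.mem_cons.1 h with h | h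
      · rcases Sym2.eq_iff.1 h with ⟨rfl, rfl⟩ | ⟨rfl, rfl⟩
        · exact hi'
        · exact absurd hxy (lt_asymm hlohi)
      · have hmem := hback _ _ h
        have hne : s(x, y) ≠ s(lo i, hi i) := by
          intro he
          rcases Sym2.eq_iff.1 he with ⟨rfl, rfl⟩ | ⟨rfl, rfl⟩
          · rw [hs, Equiv.swap_apply_left, Equiv.swap_apply_right, Sym2.eq_swap] at hmem
            exact hnot hmem
          · exact lt_asymm hxy hlohi
        have h4 := hwc _ _ (swap_lt_swap i x y hxy hne) hmem
        simpa only [pmul, Equiv.trans_apply, ← hs, hss] using h4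

theorem exists_isThurstonBraid (a : Equiv.Perm (Fin n)) : ∃ β, IsThurstonBraid a β := by
  obtain ⟨w, h1, h2, _⟩ := exists_nonRepeating_aux _ a rfl
  exact ⟨braidOf w, w, h1, h2, rfl⟩

/-- Thurston's generator `R_a`: the non-repeating braid with permutation `a`. -/
noncomputable def thurston (a : Equiv.Perm (Fin n)) : BraidGroup n :=
  (exists_isThurstonBraid a).choose

theorem thurston_spec (a : Equiv.Perm (Fin n)) : IsThurstonBraid a (thurston a) :=
  (exists_isThurstonBraid a).choose_spec

end Braids

/-! ### Words in Thurston's generators and their order -/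

/-- The alphabet: a letter `R_a` for every permutation `a ≠ ε`, and a letter `Ω⁻¹`. -/
inductive Letter (n : ℕ) : Type
  | R (a : Equiv.Perm (Fin n)) (ha : a ≠ 1) : Letter n
  | OmegaInv : Letter n

open Classical in
/-- `R_a` as a word: a letter if `a ≠ ε`, and the empty word if `a = ε`. -/
noncomputable def wordR {n : ℕ} (a : Equiv.Perm (Fin n)) : FreeMonoid (Letter n) :=
  if ha : a = 1 then 1 else FreeMonoid.of (Letter.R a ha)

/-- `Ω⁻¹` as a word. -/
def wordOmegaInv (n : ℕ) : FreeMonoid (Letter n) := FreeMonoid.of Letter.OmegaInv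

/-- The element of the braid group that a letter stands for. -/
noncomputable def letterVal {n : ℕ} : Letter n → BraidGroup n
  | Letter.R a _ => thurston a
  | Letter.OmegaInv => (thurston (omega n))⁻¹

/-- The element of the braid group that a word stands for. -/
noncomputable def wordVal (n : ℕ) : FreeMonoid (Letter n) →* BraidGroup n :=
  FreeMonoid.lift letterVal

/-- The crossings of `R_a`, listed in lexicographic order. -/
def crossingList {n : ℕ} (a : Equiv.Perm (Fin n)) : List (Fin n ×ₗ Fin n) :=
  ((inversions a).map toLex.toEmbedding).sort (· ≤ ·)

/-- The strict part of `⪯` on permutations: degree-lexicographic comparison of the lists of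
crossings. -/
def PermLT {n : ℕ} (a b : Equiv.Perm (Fin n)) : Prop :=
  List.Shortlex (· < ·) (crossingList a) (crossingList b)

/-- The order of the letters: the `R_a` are ordered by `PermLT`, and `Ω⁻¹` is the greatest
letter. -/
def LetterLT {n : ℕ} : Letter n → Letter n → Prop
  | Letter.R a _, Letter.R b _ => PermLT a b
  | Letter.R _ _, Letter.OmegaInv => True
  | Letter.OmegaInv, _ => False

/-- The degree-lexicographic order of the words. -/
def WordLT {n : ℕ} (u v : FreeMonoid (Letter n)) : Prop :=
  List.Shortlex LetterLT u.toList v.toList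

/-! ### Gröbner–Shirshov bases of ideals of a free associative algebra -/

section GroebnerShirshov

variable {X : Type*} {k : Type*} [Field k]

/-- Strict parts of monomial orders: well-founded total orders on words that are compatible with
multiplication on both sides. -/
structure IsMonomialOrder (lt : FreeMonoid X → FreeMonoid X → Prop) : Prop where
  isStrictTotalOrder : IsStrictTotalOrder (FreeMonoid X) lt
  wellFounded : WellFounded lt
  mul_lt_mul : ∀ a b u v : FreeMonoid X, lt u v → lt (a * u * b) (a * v * b)

/-- `u` is the leading word of `f`. -/
def IsLeadingWord (lt : FreeMonoid X → FreeMonoid X → Prop)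
    (f : MonoidAlgebra k (FreeMonoid X)) (u : FreeMonoid X) : Prop :=
  f.coeff u ≠ 0 ∧ ∀ v, f.coeff v ≠ 0 → v ≠ u → lt v u

/-- A word as an element of the free associative algebra `k⟨X⟩`. -/
noncomputable def monom (k : Type*) [Field k] (u : FreeMonoid X) :
    MonoidAlgebra k (FreeMonoid X) := MonoidAlgebra.single u 1

/-- `h` is trivial modulo `(S, w)`: it is a linear combination of elements `a s b` with `s ∈ S` and
`a s̄ b < w`. -/
def TrivialMod (lt : FreeMonoid X → FreeMonoid X → Prop)
    (S : Set (MonoidAlgebra k (FreeMonoid X))) (h : MonoidAlgebra k (FreeMonoid X))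
    (w : FreeMonoid X) : Prop :=
  h ∈ Submodule.span k {p | ∃ s ∈ S, ∃ u a b : FreeMonoid X,
    IsLeadingWord lt s u ∧ lt (a * u * b) w ∧ p = monom k a * s * monom k b}

/-- `S` is a Gröbner–Shirshov basis in `k⟨X⟩` with respect to the monomial order `lt`: its elements
are monic, and all compositions of intersection `f b - a g` and of inclusion `f - a g b` of its
elements are trivial. -/
structure IsGroebnerShirshov (lt : FreeMonoid X → FreeMonoid X → Prop)
    (S : Set (MonoidAlgebra k (FreeMonoid X))) : Prop where
  monomialOrder : IsMonomialOrder lt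
  monic : ∀ f ∈ S, ∃ u, IsLeadingWord lt f u ∧ f.coeff u = 1
  intersection : ∀ f ∈ S, ∀ g ∈ S, ∀ u v a b : FreeMonoid X,
    IsLeadingWord lt f u → IsLeadingWord lt g v → u * b = a * v →
    (u * b).length < u.length + v.length →
    TrivialMod lt S (f * monom k b - monom k a * g) (u * b)
  inclusion : ∀ f ∈ S, ∀ g ∈ S, ∀ u v a b : FreeMonoid X,
    IsLeadingWord lt f u → IsLeadingWord lt g v → u = a * v * b →
    TrivialMod lt S (f - monom k a * g * monom k b) u

end GroebnerShirshov

/-! ### The relations -/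

/-- The three kinds of defining relations, as pairs of words (left-hand side, right-hand side). -/
inductive Rel (n : ℕ) : FreeMonoid (Letter n) → FreeMonoid (Letter n) → Prop
  | mul (a b : Equiv.Perm (Fin n)) :
      Rel n (wordR a * wordR b) (wordR (give a b) * wordR (take a b))
  | flip (a : Equiv.Perm (Fin n)) :
      Rel n (wordOmegaInv n * wordR a) (wordR (flip a) * wordOmegaInv n)
  | omega_mul_inv : Rel n (wordR (omega n) * wordOmegaInv n) (wordR 1)
  | inv_mul_omega : Rel n (wordOmegaInv n * wordR (omega n)) (wordR 1)

/-- The relations as elements `u - v` of the free associative algebra; those whose two sides are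
the same word are left out. -/
def relPolys (n : ℕ) (k : Type*) [Field k] : Set (MonoidAlgebra k (FreeMonoid (Letter n))) :=
  {f | ∃ u v, Rel n u v ∧ u ≠ v ∧ f = monom k u - monom k v}

end BraidGS

/-! A composition is the difference of two words that are congruent modulo the relations and both
smaller than its word `w`. Rewriting lowers words, so each of the two differs from an irreducible
word by a combination that is trivial modulo `w` (`exists_irreducibleWord`). Hence all compositions
are trivial once every congruence class contains only one irreducible word
(`IrreducibleWord.eq_of_conGen`), and no overlaps need to be listed.

Uniqueness is proved in the monoid presented by the length-additive products of permutations. The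
relation `R_a R_b = R_{a ≍ b} R_{a ⋈ b}` moves the largest possible right factor of `a` onto `b`.
Sweeping a permutation through a positive word in this way is a well-defined action, because
sweeping through `ab` is sweeping through `a` and then `b` whenever the product is length-additive
(`carry_pmul`). On a normal word the sweep ends with the last letter in hand and the product of the
others behind it, so a positive braid determines its normal word. The same action shows that `Ω` can
be cancelled on the right. As `Ω²` is central, fractions `x Ω^{-2d}` of positive braids make sense,
and `Ω⁻¹` becomes `Ω · Ω⁻²`; they separate the words `R_{a_1} ⋯ R_{a_r} Ω^{-m}` that are
irreducible. The braid group plays no role in this half.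

That the relations present the braid group rests on Matsumoto's theorem
(`braidOf_eq_of_reducedWord`): reduced words of one permutation give one braid, so `thurston` is
multiplicative on length-additive products. Conversely, in the monoid defined by the relations every
`R_a` divides `Ω` on both sides and is a unit; the Artin relations hold there, which yields a map
back from the braid group. -/

namespace BraidGS

/-! ### Length-additive products and the factor passed from one permutation to the next -/

section Permutations

variable {n : ℕ}

theorem pmul_apply (a b : Equiv.Perm (Fin n)) (i : Fin n) : pmul a b i = b (a i) := rfl

theorem pmul_eq_mul (a b : Equiv.Perm (Fin n)) : pmul a b = b * a := rfl

theorem omega_apply (i : Fin n) : omega n i = i.rev := rfl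

theorem permLE_iff {a b : Equiv.Perm (Fin n)} :
    PermLE a b ↔ ∀ i j, i < j → a j < a i → b j < b i := by
  constructor
  · intro h i j hij hji
    exact ((mem_inversions b i j).1 (h ((mem_inversions a i j).2 ⟨hij, hji⟩))).2
  · rintro h ⟨i, j⟩ hij
    rw [mem_inversions] at hij ⊢
    exact ⟨hij.1, h i j hij.1 hij.2⟩

theorem permLE_compl_iff {a b : Equiv.Perm (Fin n)} :
    PermLE a (compl b) ↔ ∀ i j, i < j → a j < a i → b i < b j := by
  simp [permLE_iff, compl, pmul_apply, omega_apply, Fin.rev_lt_rev]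

/-- With equal inversion sets, `b * a⁻¹` is strictly increasing, so it has no descent and is the
identity. -/
theorem inversions_injective :
    Function.Injective (inversions : Equiv.Perm (Fin n) → Finset (Fin n × Fin n)) := by
  intro a b h
  have key : ∀ i j, a i < a j → b i < b j := by
    intro i j hij
    rcases lt_trichotomy i j with hlt | rfl | hlt
    · by_contra hn
      have hb : b j < b i := lt_of_le_of_ne (not_lt.1 hn) fun e => hlt.ne' (b.injective e)
      have : (i, j) ∈ inversions a := h ▸ (mem_inversions b i j).2 ⟨hlt, hb⟩
      exact lt_asymm hij ((mem_inversions _ _ _).1 this).2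
    · exact absurd hij (lt_irrefl _)
    · have : (j, i) ∈ inversions b := h ▸ (mem_inversions a j i).2 ⟨hlt, hij⟩
      exact ((mem_inversions _ _ _).1 this).2
  have hmono : StrictMono (b * a⁻¹) := fun x y hxy => by
    simpa using key (a⁻¹ x) (a⁻¹ y) (by simpa using hxy)
  have h1 : b * a⁻¹ = 1 := by
    by_contra hne
    obtain ⟨i, hi'⟩ := exists_descent _ hne
    exact lt_asymm hi' (hmono (show lo i < hi i by simp [lo, hi, Fin.lt_def]))
  exact (mul_inv_eq_one.1 h1).symm

theorem PermLE.refl (a : Equiv.Perm (Fin n)) : PermLE a a := Finset.Subset.refl _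

theorem PermLE.trans {a b c : Equiv.Perm (Fin n)} (h : PermLE a b) (h' : PermLE b c) :
    PermLE a c := Finset.Subset.trans h h'

theorem PermLE.antisymm {a b : Equiv.Perm (Fin n)} (h : PermLE a b) (h' : PermLE b a) : a = b :=
  inversions_injective (Finset.Subset.antisymm h h')

theorem one_permLE (a : Equiv.Perm (Fin n)) : PermLE 1 a :=
  permLE_iff.2 fun _ _ h h' => absurd h (lt_asymm h')

theorem IsMeet.meet_eq {a b x : Equiv.Perm (Fin n)} (h : IsMeet a b x) : meet a b = x :=
  have hm := meet_spec a b
  (h.2.2 _ hm.1 hm.2.1).antisymm (hm.2.2 _ h.1 h.2.1)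

/-- The product `ab` is length-additive: the pairs inverted by `a` are inverted by `ab`. -/
def Reduced (a b : Equiv.Perm (Fin n)) : Prop := PermLE a (pmul a b)

theorem reduced_iff {a b : Equiv.Perm (Fin n)} :
    Reduced a b ↔ ∀ i j, i < j → a j < a i → b (a j) < b (a i) := permLE_iff

/-- Length-additivity says that no pair of strands crosses both in `a` and in `b`; at the level
between the two factors these crossings are the inversions of `a⁻¹` and of `b`. This is what makes
the meet with `compl b` the right operation. -/
theorem reduced_iff_permLE_compl {a b : Equiv.Perm (Fin n)} :
    Reduced a b ↔ PermLE a⁻¹ (compl b) := by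
  rw [reduced_iff, permLE_compl_iff]
  constructor
  · intro h i j hij hji
    simpa using h _ _ hji (by simpa using hij)
  · intro h i j hij hji
    exact h _ _ hji (by simpa using hij)

theorem reduced_inv_inv {a b : Equiv.Perm (Fin n)} : Reduced b⁻¹ a⁻¹ ↔ Reduced a b := by
  rw [reduced_iff_permLE_compl, permLE_compl_iff, reduced_iff, inv_inv]
  constructor
  · intro h i j hij hji
    by_contra hn
    have hb : b (a i) < b (a j) :=
      lt_of_le_of_ne (not_lt.1 hn) fun e => hij.ne (a.injective (b.injective e))
    have := h _ _ hji hb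
    simp only [Equiv.symm_apply_apply, Equiv.Perm.inv_def] at this
    exact lt_asymm this hij
  · intro h i j hij hji
    by_contra hn
    have hb : a⁻¹ j < a⁻¹ i :=
      lt_of_le_of_ne (not_lt.1 hn) fun e => hij.ne' (a⁻¹.injective e)
    have := h _ _ hb (by simpa using hij)
    simp only [Equiv.apply_symm_apply, Equiv.Perm.inv_def] at this
    exact lt_asymm this hji

theorem reduced_one_left (a : Equiv.Perm (Fin n)) : Reduced 1 a := one_permLE _

theorem reduced_one_right (a : Equiv.Perm (Fin n)) : Reduced a 1 := PermLE.refl _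

/-- The product is `ω`, which inverts every pair. This makes `R_a` a left divisor of `Ω`. -/
theorem reduced_inv_pmul_omega (a : Equiv.Perm (Fin n)) : Reduced a (pmul a⁻¹ (omega n)) := by
  rw [reduced_iff]
  intro i j hij _
  simpa [pmul_apply, omega_apply, Fin.rev_lt_rev] using hij

theorem reduced_omega_pmul_inv (a : Equiv.Perm (Fin n)) : Reduced (pmul (omega n) a⁻¹) a := by
  rw [reduced_iff]
  intro i j hij _
  simpa [pmul_apply, omega_apply, Fin.rev_lt_rev] using hij

theorem compl_omega : compl (omega n) = 1 := by
  ext i; simp [compl, pmul_apply, omega_apply]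

/-- The right factor of `a` that is passed on to `b`. -/
noncomputable def carry (a b : Equiv.Perm (Fin n)) : Equiv.Perm (Fin n) := meet a⁻¹ (compl b)

theorem give_eq (a b : Equiv.Perm (Fin n)) : give a b = pmul a (carry a b) := rfl

theorem take_eq (a b : Equiv.Perm (Fin n)) : take a b = pmul (carry a b)⁻¹ b := rfl

theorem carry_isMeet (a b : Equiv.Perm (Fin n)) : IsMeet a⁻¹ (compl b) (carry a b) :=
  meet_spec _ _

theorem carry_eq_of_reduced {a b : Equiv.Perm (Fin n)} (h : Reduced a b) : carry a b = a⁻¹ :=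
  IsMeet.meet_eq ⟨PermLE.refl _, reduced_iff_permLE_compl.1 h, fun _ h' _ => h'⟩

theorem give_eq_one_of_reduced {a b : Equiv.Perm (Fin n)} (h : Reduced a b) : give a b = 1 := by
  simp [give_eq, carry_eq_of_reduced h, pmul_eq_mul]

theorem take_eq_of_reduced {a b : Equiv.Perm (Fin n)} (h : Reduced a b) : take a b = pmul a b := by
  simp [take_eq, carry_eq_of_reduced h]

/-- Nothing can be added to `ω`, which already has all inversions. -/
theorem carry_omega (a : Equiv.Perm (Fin n)) : carry a (omega n) = 1 :=
  IsMeet.meet_eq ⟨one_permLE _, one_permLE _, fun y _ h => by rwa [compl_omega] at h⟩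

theorem carry_one_left (b : Equiv.Perm (Fin n)) : carry 1 b = 1 := by
  simpa using carry_eq_of_reduced (reduced_one_left b)

theorem give_omega (a : Equiv.Perm (Fin n)) : give a (omega n) = a := by
  simp [give_eq, carry_omega, pmul_eq_mul]

theorem take_omega (a : Equiv.Perm (Fin n)) : take a (omega n) = omega n := by
  simp [take_eq, carry_omega, pmul_eq_mul]

theorem carry_reduced (a b : Equiv.Perm (Fin n)) : Reduced (carry a b)⁻¹ b := by
  rw [reduced_iff_permLE_compl, inv_inv]
  exact (carry_isMeet a b).2.1

/-- The factor that moves is `(carry a b)⁻¹`: together with `carry_reduced`, it splits off from `a`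
and joins `b` length-additively. -/
theorem give_reduced (a b : Equiv.Perm (Fin n)) : Reduced (give a b) (carry a b)⁻¹ := by
  rw [give_eq, reduced_iff]
  intro i j hij h
  simp only [pmul_apply, Equiv.symm_apply_apply, Equiv.Perm.inv_def] at *
  refine lt_of_le_of_ne (not_lt.1 fun hlt => ?_) fun e => hij.ne' (a.injective e)
  have := permLE_iff.1 (carry_isMeet a b).1 _ _ hlt h
  simp only [Equiv.Perm.inv_def, Equiv.symm_apply_apply] at this
  exact lt_asymm this hij

theorem pmul_give_carry (a b : Equiv.Perm (Fin n)) : pmul (give a b) (carry a b)⁻¹ = a := by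
  simp [give_eq, pmul_eq_mul]

theorem give_permLE (a b : Equiv.Perm (Fin n)) : PermLE (give a b) a := by
  have h := give_reduced a b
  rwa [Reduced, pmul_give_carry] at h

/-- Left multiplication by `a⁻¹` carries the permutations below `compl a` to those above `a⁻¹`,
preserving the order in both directions. It turns the lower bounds of `h⁻¹` and `compl (pmul a b)`
into candidates for the meet that defines `carry (take h a) b`. -/
theorem isMeet_pmul_carry {h a b : Equiv.Perm (Fin n)} (hab : Reduced a b) :
    IsMeet h⁻¹ (compl (pmul a b)) (pmul a (carry (take h a) b)) := by
  obtain ⟨hm1, hm2, hm3⟩ := carry_isMeet h a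
  obtain ⟨hp1, hp2, hp3⟩ := carry_isMeet (take h a) b
  have hy : (take h a)⁻¹ = pmul a⁻¹ (carry h a) := by simp [take_eq, pmul_eq_mul]
  rw [hy] at hp1 hp3
  have ham : PermLE a⁻¹ (pmul a⁻¹ (carry h a)) := by
    have := reduced_inv_inv.2 (carry_reduced h a)
    rwa [inv_inv] at this
  generalize carry (take h a) b = p at *
  generalize carry h a = m at *
  have hcomp : compl (pmul a b) = pmul a (compl b) := rfl
  have hap : PermLE a⁻¹ p := hp3 _ ham (reduced_iff_permLE_compl.1 hab)
  have hcancel : ∀ z, PermLE p z → PermLE (pmul a p) (pmul a z) := by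
    intro z hz
    rw [permLE_iff] at hap hz ⊢
    intro i j hij hji
    simp only [pmul_apply] at *
    rcases lt_trichotomy (a i) (a j) with hlt | heq | hlt
    · exact hz _ _ hlt hji
    · exact absurd (a.injective heq) hij.ne
    · have := hap _ _ hlt (by simpa using hij)
      exact absurd this (lt_asymm hji)
  refine ⟨?_, ?_, ?_⟩
  · have := hcancel _ hp1
    rw [show pmul a (pmul a⁻¹ m) = m by simp [pmul_eq_mul, mul_assoc]] at this
    exact this.trans hm1
  · rw [hcomp]
    exact hcancel _ hp2
  · intro z hz1 hz2
    -- The inversions of `a` remain inversions of `ab`, so `z` avoids them; hence `z` lies below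
    -- `carry h a` as well.
    have hza : PermLE z (compl a) := by
      rw [permLE_compl_iff] at hz2 ⊢
      intro i j hij hji
      by_contra hn
      have hlt : a j < a i := lt_of_le_of_ne (not_lt.1 hn) fun e => hij.ne' (a.injective e)
      exact lt_asymm (hz2 i j hij hji) (reduced_iff.1 hab i j hij hlt)
    have hzm := hm3 z hz1 hza
    have hmul : ∀ y, PermLE a⁻¹ (pmul a⁻¹ y) → PermLE z y →
        PermLE (pmul a⁻¹ z) (pmul a⁻¹ y) := by
      intro y hay hzy
      rw [permLE_iff] at *
      intro i j hij hji
      simp only [pmul_apply] at *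
      rcases lt_trichotomy (a⁻¹ i) (a⁻¹ j) with hlt | heq | hlt
      · exact hzy _ _ hlt hji
      · exact absurd (a⁻¹.injective heq) hij.ne
      · exact hay _ _ hij hlt
    have hzp : PermLE (pmul a⁻¹ z) p := by
      refine hp3 _ (hmul _ ham hzm) ?_
      have := hmul (compl (pmul a b)) ?_ hz2
      · rwa [show pmul a⁻¹ (compl (pmul a b)) = compl b by
          simp [compl, pmul_eq_mul, mul_assoc]] at this
      · rw [show pmul a⁻¹ (compl (pmul a b)) = compl b by
          simp [compl, pmul_eq_mul, mul_assoc]]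
        exact reduced_iff_permLE_compl.1 hab
    rw [permLE_iff] at hzp ⊢
    intro i j hij hji
    have hlt := permLE_compl_iff.1 hza i j hij hji
    exact hzp _ _ hlt (by simpa [pmul_apply] using hji)

theorem carry_pmul {h a b : Equiv.Perm (Fin n)} (hab : Reduced a b) :
    carry h (pmul a b) = pmul a (carry (take h a) b) := (isMeet_pmul_carry hab).meet_eq

theorem take_take {h a b : Equiv.Perm (Fin n)} (hab : Reduced a b) :
    take (take h a) b = take h (pmul a b) := by
  rw [take_eq h (pmul a b), carry_pmul hab, take_eq]
  simp [pmul_eq_mul, mul_assoc]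

theorem pmul_give_give {h a b : Equiv.Perm (Fin n)} (hab : Reduced a b) :
    pmul (give h a) (give (take h a) b) = give h (pmul a b) := by
  rw [give_eq h (pmul a b), carry_pmul hab, give_eq, give_eq, take_eq]
  simp [pmul_eq_mul, mul_assoc]

/-- A longer `pmul a b` accepts less of `h`, so `carry h (pmul a b)` lies below `carry h a` and at
least as many inversions of `h` stay behind. -/
theorem reduced_give_give {h a b : Equiv.Perm (Fin n)} (hab : Reduced a b) :
    Reduced (give h a) (give (take h a) b) := by
  rw [Reduced, pmul_give_give hab, permLE_iff]
  have hcc : PermLE (carry h (pmul a b)) (carry h a) := by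
    refine (carry_isMeet h a).2.2 _ (carry_isMeet _ _).1 ?_
    have h2 := (carry_isMeet h (pmul a b)).2.1
    rw [permLE_compl_iff] at h2 ⊢
    intro i j hij hji
    by_contra hn
    have hlt : a j < a i := lt_of_le_of_ne (not_lt.1 hn) fun e => hij.ne' (a.injective e)
    exact lt_asymm (h2 i j hij hji) (reduced_iff.1 hab i j hij hlt)
  intro i j hij hji
  simp only [give_eq, pmul_apply] at *
  have hQP : h j < h i := by
    refine lt_of_le_of_ne (not_lt.1 fun hlt => ?_) fun e => hij.ne' (h.injective e)
    have := permLE_iff.1 (carry_isMeet h a).1 _ _ hlt hji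
    rw [Equiv.Perm.inv_def, Equiv.symm_apply_apply, Equiv.symm_apply_apply] at this
    exact lt_asymm this hij
  refine lt_of_le_of_ne (not_lt.1 fun hlt => ?_) fun e => hQP.ne (Equiv.injective _ e)
  exact lt_asymm hji (permLE_iff.1 hcc _ _ hQP hlt)

end Permutations

/-! ### Positive braids: the sweeping action and uniqueness of normal words -/

section PositiveMonoid

variable {n : ℕ}

/-- The Garside relations: a length-additive product of permutations is a product of the
corresponding positive braids. -/
inductive GarsideRel (n : ℕ) :
    FreeMonoid (Equiv.Perm (Fin n)) → FreeMonoid (Equiv.Perm (Fin n)) → Prop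
  | mul (a b : Equiv.Perm (Fin n)) (h : Reduced a b) :
      GarsideRel n (FreeMonoid.of a * FreeMonoid.of b) (FreeMonoid.of (pmul a b))
  | one : GarsideRel n (FreeMonoid.of 1) 1

/-- The monoid of positive braids, presented by permutations and the Garside relations. -/
abbrev PositiveMonoid (n : ℕ) : Type := (conGen (GarsideRel n)).Quotient

namespace PositiveMonoid

/-- The positive braid of a permutation. -/
def simple (a : Equiv.Perm (Fin n)) : PositiveMonoid n :=
  (conGen (GarsideRel n)).mk' (FreeMonoid.of a)

theorem simple_mul_simple {a b : Equiv.Perm (Fin n)} (h : Reduced a b) :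
    simple a * simple b = simple (pmul a b) :=
  (Con.eq _).2 (ConGen.Rel.of _ _ (GarsideRel.mul a b h))

theorem simple_one : simple (1 : Equiv.Perm (Fin n)) = 1 :=
  (Con.eq _).2 (ConGen.Rel.of _ _ GarsideRel.one)

section Lift

variable {N : Type*} [Monoid N] (f : Equiv.Perm (Fin n) → N)
  (hmul : ∀ a b, Reduced a b → f a * f b = f (pmul a b)) (hone : f 1 = 1)

/-- The universal property of the positive braid monoid. -/
def lift : PositiveMonoid n →* N :=
  (conGen (GarsideRel n)).lift (FreeMonoid.lift f) (Con.conGen_le.2 (by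
    rintro _ _ (⟨a, b, h⟩ | _)
    · simpa [Con.ker_rel] using hmul a b h
    · simpa [Con.ker_rel] using hone))

theorem lift_simple (a : Equiv.Perm (Fin n)) : lift f hmul hone (simple a) = f a := by
  simp [lift, simple]

end Lift

theorem induction_simple {p : PositiveMonoid n → Prop} (one : p 1)
    (mul : ∀ a x, p x → p (simple a * x)) (x : PositiveMonoid n) : p x := by
  induction x using Con.induction_on with
  | _ w =>
    induction w using FreeMonoid.inductionOn' with
    | one => exact one
    | of_mul a w ih => exact mul a _ ih

/-- Split the moving factor off `a` and absorb it into `b`; both steps are length-additive. -/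
theorem simple_mul_simple_eq (a b : Equiv.Perm (Fin n)) :
    simple a * simple b = simple (give a b) * simple (take a b) := by
  rw [take_eq, ← simple_mul_simple (carry_reduced a b), ← mul_assoc,
    simple_mul_simple (give_reduced a b), pmul_give_carry]

theorem omega_mul_simple (a : Equiv.Perm (Fin n)) :
    simple (omega n) * simple a = simple (flip a) * simple (omega n) := by
  have hc : carry (omega n) a = compl a :=
    IsMeet.meet_eq ⟨permLE_iff.2 fun i j hij _ => Fin.rev_lt_rev.2 hij, PermLE.refl _,
      fun _ _ h => h⟩
  have ht : take (omega n) a = omega n := by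
    simp [take_eq, hc, compl, pmul_eq_mul]
    rfl
  rw [simple_mul_simple_eq, ht, give_eq, hc]
  rfl

theorem flip_flip (a : Equiv.Perm (Fin n)) : flip (flip a) = a := by
  ext i; simp [flip, pmul_apply, omega_apply]

/-- The full twist `Ω²`. -/
def fullTwist (n : ℕ) : PositiveMonoid n := simple (omega n) * simple (omega n)

theorem fullTwist_comm (x : PositiveMonoid n) : fullTwist n * x = x * fullTwist n := by
  induction x using induction_simple with
  | one => simp
  | mul a x ih =>
    have h : fullTwist n * simple a = simple a * fullTwist n := by
      rw [fullTwist, mul_assoc, omega_mul_simple, ← mul_assoc, omega_mul_simple, flip_flip,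
        mul_assoc]
    rw [← mul_assoc, h, mul_assoc, ih, mul_assoc]

/-- Sweeping a permutation braid through a word from left to right: a state `(x, h)` reads a
letter `a`, appends `give h a` to `x` and keeps `take h a`. -/
noncomputable def step (a : Equiv.Perm (Fin n)) (s : PositiveMonoid n × Equiv.Perm (Fin n)) :
    PositiveMonoid n × Equiv.Perm (Fin n) :=
  (s.1 * simple (give s.2 a), take s.2 a)

theorem step_step {a b : Equiv.Perm (Fin n)} (h : Reduced a b)
    (s : PositiveMonoid n × Equiv.Perm (Fin n)) : step b (step a s) = step (pmul a b) s := by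
  simp only [step, mul_assoc, simple_mul_simple (reduced_give_give h), pmul_give_give h,
    take_take h]

theorem step_one (s : PositiveMonoid n × Equiv.Perm (Fin n)) : step 1 s = s := by
  simp [step, give_eq_one_of_reduced (reduced_one_right _), take_eq_of_reduced
    (reduced_one_right _), simple_one, pmul_eq_mul]

/-- The right action of positive braids by sweeping. -/
noncomputable def sweep :
    PositiveMonoid n →* (Function.End (PositiveMonoid n × Equiv.Perm (Fin n)))ᵐᵒᵖ :=
  lift (fun a => MulOpposite.op (step a))
    (fun _ _ h => congrArg MulOpposite.op (funext fun s => step_step h s))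
    (congrArg MulOpposite.op (funext step_one))

theorem sweep_mul (x y : PositiveMonoid n) (s : PositiveMonoid n × Equiv.Perm (Fin n)) :
    (sweep (x * y)).unop s = (sweep y).unop ((sweep x).unop s) := by
  rw [map_mul]; rfl

theorem sweep_simple (a : Equiv.Perm (Fin n)) (s : PositiveMonoid n × Equiv.Perm (Fin n)) :
    (sweep (simple a)).unop s = step a s := by
  rw [sweep, lift_simple]; rfl

theorem sweep_spec (x : PositiveMonoid n) (s : PositiveMonoid n × Equiv.Perm (Fin n)) :
    ((sweep x).unop s).1 * simple ((sweep x).unop s).2 = s.1 * simple s.2 * x := by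
  induction x using induction_simple generalizing s with
  | one => simp; rfl
  | mul a x ih =>
    rw [sweep_mul, sweep_simple, ih, step]
    simp only [mul_assoc]
    rw [← mul_assoc (simple (give _ _)), ← simple_mul_simple_eq, mul_assoc]

theorem sweep_one_spec (x : PositiveMonoid n) :
    ((sweep x).unop (1, 1)).1 * simple ((sweep x).unop (1, 1)).2 = x := by
  simp [sweep_spec, simple_one]

/-- Since `give h ω = h`, sweeping through a final `Ω` drops everything held, so the first component
of the state is the whole of `x`. -/
theorem mul_omega_cancel {x y : PositiveMonoid n}
    (h : x * simple (omega n) = y * simple (omega n)) : x = y := by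
  have key : ∀ z : PositiveMonoid n, ((sweep (z * simple (omega n))).unop (1, 1)).1 = z := by
    intro z
    rw [sweep_mul, sweep_simple, step, give_omega]
    exact sweep_one_spec z
  rw [← key x, h, key]

theorem mul_fullTwist_pow_cancel {x y : PositiveMonoid n} (k : ℕ)
    (h : x * fullTwist n ^ k = y * fullTwist n ^ k) : x = y := by
  induction k with
  | zero => simpa using h
  | succ k ih =>
    rw [pow_succ, ← mul_assoc, ← mul_assoc, fullTwist, ← mul_assoc, ← mul_assoc] at h
    exact ih (mul_omega_cancel (mul_omega_cancel h))

/-- The pair `(a, b)` is reduced for the relation `R_a R_b = R_{a ≍ b} R_{a ⋈ b}`. -/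
def NormalPair (a b : Equiv.Perm (Fin n)) : Prop := give a b = a ∧ take a b = b

theorem normalPair_omega (a : Equiv.Perm (Fin n)) : NormalPair a (omega n) :=
  ⟨give_omega a, take_omega a⟩

/-- The words that are reduced for the relations `R_a R_b = R_{a ≍ b} R_{a ⋈ b}`. -/
def NormalWord (l : List (Equiv.Perm (Fin n))) : Prop :=
  l.IsChain NormalPair ∧ ∀ a ∈ l, a ≠ 1

/-- The positive braid of a word in the permutation braids. -/
def ofWord (l : List (Equiv.Perm (Fin n))) : PositiveMonoid n := (l.map simple).prod

theorem ofWord_append (l l' : List (Equiv.Perm (Fin n))) :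
    ofWord (l ++ l') = ofWord l * ofWord l' := by simp [ofWord]

/-- Across a normal pair the held permutation is dropped whole and the new letter is picked up
unchanged. The default `1` is the permutation held at the start. -/
theorem sweep_ofWord_snd {l : List (Equiv.Perm (Fin n))} (h : l.IsChain NormalPair) :
    ((sweep (ofWord l)).unop (1, 1)).2 = l.getLast?.getD 1 := by
  induction l using List.reverseRecOn with
  | nil => simp [ofWord]; rfl
  | append_singleton l a ih =>
    rw [ofWord_append, sweep_mul]
    have h1 : ofWord [a] = simple a := by simp [ofWord]
    rw [List.isChain_append] at h
    rw [h1, sweep_simple, step, ih h.1]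
    cases hl : l.getLast? with
    | none => simp [take_eq, carry_one_left, pmul_eq_mul]
    | some b => simpa using (h.2.2 b (by simp [hl]) a (by simp)).2

theorem sweep_ofWord_fst {l : List (Equiv.Perm (Fin n))} {a : Equiv.Perm (Fin n)}
    (h : (l ++ [a]).IsChain NormalPair) :
    ((sweep (ofWord (l ++ [a]))).unop (1, 1)).1 = ofWord l := by
  rw [ofWord_append, sweep_mul]
  have h1 : ofWord [a] = simple a := by simp [ofWord]
  rw [List.isChain_append] at h
  have hgive : give ((sweep (ofWord l)).unop (1, 1)).2 a = ((sweep (ofWord l)).unop (1, 1)).2 := by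
    rw [sweep_ofWord_snd h.1]
    cases hl : l.getLast? with
    | none => simp [give_eq, carry_one_left, pmul_eq_mul]
    | some b => simpa using (h.2.2 b (by simp [hl]) a (by simp)).1
  rw [h1, sweep_simple, step, hgive]
  exact sweep_one_spec _

/-- The sweep reads off the last letter and the product of the remaining ones, so the letters are
recovered from right to left. -/
theorem NormalWord.eq_of_ofWord_eq {l l' : List (Equiv.Perm (Fin n))} (hl : NormalWord l)
    (hl' : NormalWord l') (h : ofWord l = ofWord l') : l = l' := by
  induction l using List.reverseRecOn generalizing l' with
  | nil =>
    have h2 := sweep_ofWord_snd hl'.1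
    rw [← h, sweep_ofWord_snd hl.1] at h2
    rcases List.eq_nil_or_concat l' with rfl | ⟨t, b, rfl⟩
    · rfl
    -- The empty word ends with `1` in hand, which is never the last letter of a normal word.
    · exact absurd (by simpa using h2.symm) (hl'.2 b (by simp))
  | append_singleton l a ih =>
    have h2 := sweep_ofWord_snd hl'.1
    rw [← h, sweep_ofWord_snd hl.1] at h2
    rcases List.eq_nil_or_concat l' with rfl | ⟨t, b, rfl⟩
    · simp at h2
      exact absurd h2 (hl.2 a (by simp))
    · rw [List.concat_eq_append] at *
      have hab : a = b := by simpa using h2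
      subst hab
      have h1 := sweep_ofWord_fst hl'.1
      rw [← h, sweep_ofWord_fst hl.1] at h1
      rw [ih ⟨(List.isChain_append.1 hl.1).1, fun c hc => hl.2 c (by simp [hc])⟩
        ⟨(List.isChain_append.1 hl'.1).1, fun c hc => hl'.2 c (by simp [hc])⟩ h1]

end PositiveMonoid

end PositiveMonoid

/-! ### Fractions of positive braids and uniqueness of irreducible words -/

section Words

variable {n : ℕ}

theorem wordR_one : wordR (1 : Equiv.Perm (Fin n)) = 1 := by simp [wordR]

theorem wordR_of_ne {a : Equiv.Perm (Fin n)} (ha : a ≠ 1) :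
    wordR a = FreeMonoid.of (Letter.R a ha) := by simp [wordR, ha]

open PositiveMonoid

/-- A letter as a fraction of positive braids: the pair `(x, d)` stands for `x Ω^{-2d}`. -/
def letterFrac : Letter n → PositiveMonoid n × Multiplicative ℕ
  | Letter.R a _ => (simple a, 1)
  | Letter.OmegaInv => (simple (omega n), Multiplicative.ofAdd 1)

/-- A word as a fraction of positive braids. -/
def frac : FreeMonoid (Letter n) →* PositiveMonoid n × Multiplicative ℕ :=
  FreeMonoid.lift letterFrac

theorem frac_wordR (a : Equiv.Perm (Fin n)) : frac (wordR a) = (simple a, 1) := by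
  by_cases ha : a = 1
  · subst ha; rw [wordR_one, map_one, simple_one]; rfl
  · rw [wordR_of_ne ha, frac, FreeMonoid.lift_eval_of]; rfl

theorem frac_wordOmegaInv :
    frac (wordOmegaInv n) = (simple (omega n), Multiplicative.ofAdd 1) := by
  rw [wordOmegaInv, frac, FreeMonoid.lift_eval_of]; rfl

/-- The numerator of a word. -/
def num (w : FreeMonoid (Letter n)) : PositiveMonoid n := (frac w).1

/-- The exponent of the full twist in the denominator of a word. -/
def den (w : FreeMonoid (Letter n)) : ℕ := (frac w).2.toAdd

theorem num_mul (u v : FreeMonoid (Letter n)) : num (u * v) = num u * num v := by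
  simp [num]

theorem den_mul (u v : FreeMonoid (Letter n)) : den (u * v) = den u + den v := by
  simp [den]

theorem fullTwist_pow_comm (k : ℕ) (x : PositiveMonoid n) :
    fullTwist n ^ k * x = x * fullTwist n ^ k :=
  (Commute.pow_left (fullTwist_comm x) k).eq

/-- Equality of the fractions of positive braids given by two words. -/
def fracCon (n : ℕ) : Con (FreeMonoid (Letter n)) where
  r u v := num u * fullTwist n ^ den v = num v * fullTwist n ^ den u
  iseqv := by
    refine ⟨fun _ => rfl, fun h => h.symm, ?_⟩
    intro u v w h1 h2
    -- Transitivity of equality of fractions is where cancellation is needed; compatibility with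
    -- products needs only centrality.
    apply mul_fullTwist_pow_cancel (den v)
    calc num u * fullTwist n ^ den w * fullTwist n ^ den v
        = num u * fullTwist n ^ den v * fullTwist n ^ den w := by
          rw [mul_assoc, mul_assoc, ← pow_add, ← pow_add, add_comm]
      _ = num v * fullTwist n ^ den w * fullTwist n ^ den u := by
          rw [h1, mul_assoc, mul_assoc, ← pow_add, ← pow_add, add_comm]
      _ = num w * fullTwist n ^ den u * fullTwist n ^ den v := by
          rw [h2, mul_assoc, mul_assoc, ← pow_add, ← pow_add, add_comm]
  mul' := by
    intro u u' v v' h1 h2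
    rw [num_mul, num_mul, den_mul, den_mul, pow_add, pow_add]
    calc num u * num v * (fullTwist n ^ den u' * fullTwist n ^ den v')
        = num u * fullTwist n ^ den u' * (num v * fullTwist n ^ den v') := by
          simp only [mul_assoc]
          rw [← mul_assoc (num v), ← fullTwist_pow_comm (den u') (num v), mul_assoc]
      _ = num u' * fullTwist n ^ den u * (num v' * fullTwist n ^ den v) := by rw [h1, h2]
      _ = num u' * num v' * (fullTwist n ^ den u * fullTwist n ^ den v) := by
          simp only [mul_assoc]
          rw [← mul_assoc (num v'), ← fullTwist_pow_comm (den u) (num v'), mul_assoc]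

/-- With `Ω⁻¹` read as `Ω · Ω⁻²`, the flip relation becomes `omega_mul_simple`, and the inverse
relations say that `Ω · Ω` is the full twist. -/
theorem conGen_rel_le_fracCon : conGen (Rel n) ≤ fracCon n := by
  rw [Con.conGen_le]
  rintro _ _ (⟨a, b⟩ | a | _ | _) <;>
    change num _ * fullTwist n ^ den _ = num _ * fullTwist n ^ den _ <;>
    simp only [num, den, map_mul, frac_wordR, frac_wordOmegaInv, Prod.fst_mul, Prod.snd_mul,
      toAdd_one, toAdd_ofAdd, simple_one, pow_zero, pow_one, mul_one, one_mul]
  · exact simple_mul_simple_eq a b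
  · rw [omega_mul_simple]
  · rfl
  · rfl

/-- The word `R_{a_1} ⋯ R_{a_r} Ω^{-m}`. -/
noncomputable def normalForm (l : List (Equiv.Perm (Fin n))) (m : ℕ) : FreeMonoid (Letter n) :=
  (l.map wordR).prod * wordOmegaInv n ^ m

theorem num_normalForm (l : List (Equiv.Perm (Fin n))) (m : ℕ) :
    num (normalForm l m) = ofWord (l ++ List.replicate m (omega n)) := by
  have h1 : num (l.map wordR).prod = ofWord l := by
    induction l with
    | nil => simp [num, ofWord]
    | cons a l ih =>
      rw [List.map_cons, List.prod_cons, num_mul, ih]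
      simp [ofWord, num, frac_wordR]
  rw [normalForm, num_mul, h1, ofWord_append]
  simp [num, ofWord, frac_wordOmegaInv]

theorem den_normalForm (l : List (Equiv.Perm (Fin n))) (m : ℕ) :
    den (normalForm l m) = m := by
  have h1 : den (l.map wordR).prod = 0 := by
    induction l with
    | nil => simp [den]
    | cons a l ih =>
      rw [List.map_cons, List.prod_cons, den_mul, ih]
      simp [den, frac_wordR]
  rw [normalForm, den_mul, h1]
  simp [den, frac_wordOmegaInv]

/-- The pairs `(l, m)` for which `normalForm l m` is reduced. -/
def IsNormal (l : List (Equiv.Perm (Fin n))) (m : ℕ) : Prop :=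
  NormalWord l ∧ (m ≠ 0 → l.getLast? ≠ some (omega n))

/-- Every pair ending in `ω` is normal, so the numerators of normal forms, and their multiples by
full twists, are still normal words. -/
theorem PositiveMonoid.NormalWord.append_replicate_omega (hn : omega n ≠ 1) {l : List (Equiv.Perm (Fin n))}
    (h : NormalWord l) (m : ℕ) : NormalWord (l ++ List.replicate m (omega n)) := by
  induction m with
  | zero => simpa using h
  | succ m ih =>
    rw [List.replicate_succ', ← List.append_assoc]
    refine ⟨List.isChain_append.2 ⟨ih.1, List.isChain_singleton _, ?_⟩, ?_⟩
    · intro x _ y hy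
      simp only [List.head?_cons, Option.mem_def, Option.some.injEq] at hy
      exact hy ▸ normalPair_omega x
    · intro a ha
      rcases List.mem_append.1 ha with ha | ha
      · exact ih.2 a ha
      · rwa [List.mem_singleton.1 ha]

theorem IsNormal.append_ne {l l' : List (Equiv.Perm (Fin n))} {m m' : ℕ}
    (h : IsNormal l m) (hlt : m' < m) :
    l ++ List.replicate m' (omega n) ≠ l' ++ List.replicate m (omega n) := by
  intro he
  obtain ⟨d, rfl⟩ := Nat.exists_eq_add_of_lt hlt
  rw [show m' + d + 1 = (d + 1) + m' by ring, List.replicate_add, ← List.append_assoc] at he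
  have he := List.append_cancel_right he
  apply h.2 (by omega)
  rw [he, List.replicate_succ', ← List.append_assoc]
  simp

theorem normalForm_unique (hn : omega n ≠ 1) {l l' : List (Equiv.Perm (Fin n))} {m m' : ℕ}
    (h : IsNormal l m) (h' : IsNormal l' m')
    (he : conGen (Rel n) (normalForm l m) (normalForm l' m')) : l = l' ∧ m = m' := by
  have h1 : num (normalForm l m) * fullTwist n ^ den (normalForm l' m') =
    num (normalForm l' m') * fullTwist n ^ den (normalForm l m) := conGen_rel_le_fracCon he
  have hpow : ∀ k, fullTwist n ^ k = ofWord (List.replicate (2 * k) (omega n)) := by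
    intro k
    simp [ofWord, fullTwist, pow_mul, sq]
  rw [num_normalForm, num_normalForm, den_normalForm, den_normalForm, hpow, hpow, ← ofWord_append,
    ← ofWord_append, List.append_assoc, List.append_assoc, ← List.replicate_add,
    ← List.replicate_add] at h1
  have h2 := (h.1.append_replicate_omega hn _).eq_of_ofWord_eq
    (h'.1.append_replicate_omega hn _) h1
  -- Removing the `m + m'` common trailing letters leaves `m'` copies of `ω` after `l` and `m` after
  -- `l'`; if these numbers differ, `l` or `l'` ends in `ω`, which normality forbids.
  rw [show m + 2 * m' = m' + (m + m') by ring, show m' + 2 * m = m + (m + m') by ring,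
    List.replicate_add m', List.replicate_add m (m + m'), ← List.append_assoc,
    ← List.append_assoc] at h2
  have h3 := List.append_cancel_right h2
  have hm : m = m' := by
    rcases lt_trichotomy m m' with hlt | heq | hlt
    · exact (h'.append_ne hlt h3.symm).elim
    · exact heq
    · exact (h.append_ne hlt h3).elim
  subst hm
  exact ⟨List.append_cancel_right h3, rfl⟩

theorem wordR_mul_wordR_inj {a b c d : Equiv.Perm (Fin n)} (ha : a ≠ 1) (hb : b ≠ 1)
    (h : wordR a * wordR b = wordR c * wordR d) : a = c ∧ b = d := by
  by_cases hc : c = 1 <;> by_cases hd : d = 1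
  · have := congrArg FreeMonoid.length h
    simp [wordR, ha, hb, hc, hd] at this
  · have := congrArg FreeMonoid.length h
    simp [wordR, ha, hb, hc, hd] at this
  · have := congrArg FreeMonoid.length h
    simp [wordR, ha, hb, hc, hd] at this
  · have := congrArg FreeMonoid.toList h
    simpa [wordR, ha, hb, hc, hd] using this

theorem wordOmegaInv_mul_wordR_ne {a b : Equiv.Perm (Fin n)} (ha : a ≠ 1) :
    wordOmegaInv n * wordR a ≠ wordR b * wordOmegaInv n := by
  intro h
  by_cases hb : b = 1
  · have := congrArg FreeMonoid.length h
    simp [wordR, wordOmegaInv, ha, hb] at this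
  · have := congrArg FreeMonoid.toList h
    simp [wordR, wordOmegaInv, ha, hb] at this

theorem mul_wordOmegaInv_ne_one (w : FreeMonoid (Letter n)) : w * wordOmegaInv n ≠ 1 := by
  intro h
  have := congrArg FreeMonoid.length h
  simp [wordOmegaInv] at this

/-- A word is irreducible if it contains no left-hand side of a nontrivial relation. -/
def IrreducibleWord (w : FreeMonoid (Letter n)) : Prop :=
  ∀ p q u v, w = p * u * q → Rel n u v → u = v

/-- Forbidding `Ω⁻¹R_a` pushes every `Ω⁻¹` to the end, forbidding nontrivial `R_a R_b` makes
adjacent pairs normal, and forbidding `ΩΩ⁻¹` keeps `ω` away from the boundary. -/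
theorem IrreducibleWord.exists_normalForm {w : FreeMonoid (Letter n)} (h : IrreducibleWord w) :
    ∃ l m, IsNormal l m ∧ w = normalForm l m := by
  induction w using FreeMonoid.inductionOn' with
  | one => exact ⟨[], 0, ⟨⟨by simp, by simp⟩, by simp⟩, by simp [normalForm]⟩
  | of_mul x w ih =>
    obtain ⟨l, m, hlm, hw⟩ := ih fun p q u v hp => h (FreeMonoid.of x * p) q u v (by
      rw [hp]; simp only [mul_assoc])
    cases x with
    | R a ha =>
      rw [← wordR_of_ne ha] at h ⊢
      refine ⟨a :: l, m, ⟨⟨List.isChain_cons.2 ⟨?_, hlm.1.1⟩, ?_⟩, ?_⟩,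
        by simp [normalForm, hw, mul_assoc]⟩
      · intro b hb
        cases l with
        | nil => simp at hb
        | cons c l =>
          obtain rfl : c = b := by simpa using hb
          have := wordR_mul_wordR_inj ha (hlm.1.2 c (by simp))
            (h 1 (normalForm l m) _ _ (by simp [hw, normalForm, mul_assoc]) (Rel.mul a c))
          exact ⟨this.1.symm, this.2.symm⟩
      · intro b hb
        rcases List.mem_cons.1 hb with rfl | hb
        · exact ha
        · exact hlm.1.2 b hb
      · intro hm
        cases l with
        | nil =>
          intro hω
          obtain rfl : a = omega n := by simpa using hω
          obtain ⟨m, rfl⟩ := Nat.exists_eq_succ_of_ne_zero hm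
          refine mul_wordOmegaInv_ne_one _ ((h 1 (wordOmegaInv n ^ m) _ _ ?_
            Rel.omega_mul_inv).trans wordR_one)
          simp [hw, normalForm, pow_succ', mul_assoc]
        | cons c l => simpa using hlm.2 hm
    | OmegaInv =>
      change IrreducibleWord (wordOmegaInv n * w) at h
      change ∃ l m, IsNormal l m ∧ wordOmegaInv n * w = normalForm l m
      cases l with
      | nil =>
        refine ⟨[], m + 1, ⟨hlm.1, by simp⟩, ?_⟩
        simp [hw, normalForm, pow_succ']
      | cons c l =>
        refine (wordOmegaInv_mul_wordR_ne (hlm.1.2 c (by simp))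
          (h 1 (normalForm l m) _ _ ?_ (Rel.flip c))).elim
        simp [hw, normalForm, mul_assoc]

theorem IrreducibleWord.eq_of_conGen (hn : omega n ≠ 1) {w w' : FreeMonoid (Letter n)}
    (h : IrreducibleWord w) (h' : IrreducibleWord w') (he : conGen (Rel n) w w') : w = w' := by
  obtain ⟨l, m, hl, rfl⟩ := h.exists_normalForm
  obtain ⟨l', m', hl', rfl⟩ := h'.exists_normalForm
  obtain ⟨rfl, rfl⟩ := normalForm_unique hn hl hl' he
  rfl

end Words

/-! ### The degree-lexicographic order is monomial and the relations decrease words -/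

section Order

variable {n : ℕ}

theorem shortlex_append_right {α : Type*} {r : α → α → Prop} {s t : List α}
    (h : List.Shortlex r s t) (l : List α) : List.Shortlex r (s ++ l) (t ++ l) := by
  rw [List.shortlex_def] at h ⊢
  rcases h with h | ⟨hlen, hlex⟩
  · left; simpa using h
  · refine Or.inr ⟨by simpa using hlen, ?_⟩
    induction hlex with
    | nil => simp at hlen
    | cons _ ih => exact List.Lex.cons (ih (by simpa using hlen))
    | rel h => exact List.Lex.rel h

theorem lex_trans {α : Type*} {r : α → α → Prop} [IsTrans α r] {s t u : List α}
    (h : List.Lex r s t) (h' : List.Lex r t u) : List.Lex r s u := by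
  induction h generalizing u with
  | nil => cases h' <;> exact List.Lex.nil
  | cons _ ih =>
    cases h' with
    | cons h' => exact List.Lex.cons (ih h')
    | rel h' => exact List.Lex.rel h'
  | rel h =>
    cases h' with
    | cons _ => exact List.Lex.rel h
    | rel h' => exact List.Lex.rel (_root_.trans h h')

theorem shortlex_trans {α : Type*} {r : α → α → Prop} [IsTrans α r] {s t u : List α}
    (h : List.Shortlex r s t) (h' : List.Shortlex r t u) : List.Shortlex r s u := by
  rw [List.shortlex_def] at h h' ⊢
  rcases h with h | ⟨hlen, hlex⟩ <;> rcases h' with h' | ⟨hlen', hlex'⟩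
  · exact Or.inl (h.trans h')
  · exact Or.inl (hlen' ▸ h)
  · exact Or.inl (hlen ▸ h')
  · exact Or.inr ⟨hlen.trans hlen', lex_trans hlex hlex'⟩

theorem crossingList_injective :
    Function.Injective (crossingList : Equiv.Perm (Fin n) → List (Fin n ×ₗ Fin n)) := by
  intro a b h
  have h1 := congrArg List.toFinset h
  simp only [crossingList, Finset.sort_toFinset, Finset.map_inj] at h1
  exact inversions_injective h1

theorem length_crossingList (a : Equiv.Perm (Fin n)) :
    (crossingList a).length = (inversions a).card := by
  simp [crossingList]

theorem PermLT.trans {a b c : Equiv.Perm (Fin n)} (h : PermLT a b) (h' : PermLT b c) :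
    PermLT a c := shortlex_trans h h'

theorem PermLT.irrefl (a : Equiv.Perm (Fin n)) : ¬ PermLT a a :=
  fun h => Std.Asymm.asymm (r := List.Shortlex (· < ·)) _ _ h h

theorem permLT_trichotomous (a b : Equiv.Perm (Fin n)) : PermLT a b ∨ a = b ∨ PermLT b a := by
  have := trichotomous_of (List.Shortlex (· < ·)) (crossingList a) (crossingList b)
  rwa [crossingList_injective.eq_iff] at this

instance letterLT_isStrictTotalOrder : IsStrictTotalOrder (Letter n) LetterLT where
  irrefl
    | Letter.R a _ => PermLT.irrefl a
    | Letter.OmegaInv => id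
  trans
    | Letter.R _ _, Letter.R _ _, Letter.R _ _, h, h' => PermLT.trans h h'
    | Letter.R _ _, Letter.R _ _, Letter.OmegaInv, _, _ => trivial
    | Letter.R _ _, Letter.OmegaInv, _, _, h => h.elim
    | Letter.OmegaInv, _, _, h, _ => h.elim
  trichotomous
    | Letter.R a _, Letter.R b _, h, h' => by
      have := (permLT_trichotomous a b).resolve_left h
      simpa using this.resolve_right h'
    | Letter.R _ _, Letter.OmegaInv, h, _ => (h trivial).elim
    | Letter.OmegaInv, Letter.R _ _, _, h => (h trivial).elim
    | Letter.OmegaInv, Letter.OmegaInv, _, _ => rfl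

theorem letter_finite : Finite (Letter n) := by
  refine Finite.of_injective (β := Option (Equiv.Perm (Fin n)))
    (fun | Letter.R a _ => some a | Letter.OmegaInv => none) ?_
  rintro (_ | _) (_ | _) h <;> simp_all

theorem isMonomialOrder_wordLT : IsMonomialOrder (WordLT (n := n)) where
  isStrictTotalOrder :=
    { irrefl := fun _ h => Std.Asymm.asymm (r := List.Shortlex (LetterLT (n := n))) _ _ h h
      trans := fun _ _ _ => shortlex_trans
      trichotomous := fun u v =>
        Std.Trichotomous.trichotomous (r := List.Shortlex (LetterLT (n := n))) u.toList v.toList }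
  wellFounded := by
    have := letter_finite (n := n)
    exact InvImage.wf _ (List.Shortlex.wf (Finite.wellFounded_of_trans_of_irrefl _))
  mul_lt_mul a b u v h := shortlex_append_right (List.Shortlex.append_left h a.toList) b.toList

theorem permLT_give {a b : Equiv.Perm (Fin n)} (h : give a b ≠ a) : PermLT (give a b) a := by
  apply List.Shortlex.of_length_lt
  rw [length_crossingList, length_crossingList]
  exact Finset.card_lt_card ((give_permLE a b).ssubset_of_ne fun e => h (inversions_injective e))

theorem length_wordR_le (a : Equiv.Perm (Fin n)) : (wordR a).length ≤ 1 := by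
  by_cases ha : a = 1 <;> simp [wordR, ha]

theorem wordLT_of_length_lt {u v : FreeMonoid (Letter n)} (h : u.length < v.length) :
    WordLT u v := List.Shortlex.of_length_lt h

theorem wordLT_of_letterLT {x y x' y' : Letter n} (h : LetterLT x x') :
    WordLT (FreeMonoid.of x * FreeMonoid.of y) (FreeMonoid.of x' * FreeMonoid.of y') :=
  List.Shortlex.of_lex rfl (List.Lex.rel h)

/-- Either a letter disappears, or the first letter loses inversions, or the greatest letter `Ω⁻¹`
leaves the first place. -/
theorem Rel.wordLT {u v : FreeMonoid (Letter n)} (h : Rel n u v) (hne : u ≠ v) : WordLT v u := by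
  cases h with
  | mul a b =>
    by_cases ha : a = 1
    · subst ha
      exact absurd (by simp [give_eq, take_eq, carry_one_left, pmul_eq_mul]) hne
    by_cases hb : b = 1
    · subst hb
      refine absurd ?_ hne
      rw [give_eq_one_of_reduced (reduced_one_right a), take_eq_of_reduced (reduced_one_right a)]
      simp [wordR_one, pmul_eq_mul]
    by_cases hg : give a b = 1
    · apply wordLT_of_length_lt
      have := length_wordR_le (take a b)
      simp only [wordR_of_ne ha, wordR_of_ne hb, hg, wordR_one, one_mul, FreeMonoid.length_mul,
        FreeMonoid.length_of]
      omega
    by_cases ht : take a b = 1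
    · apply wordLT_of_length_lt
      simp [wordR_of_ne ha, wordR_of_ne hb, wordR_of_ne hg, ht, wordR_one]
    rw [wordR_of_ne ha, wordR_of_ne hb, wordR_of_ne hg, wordR_of_ne ht] at *
    -- If the first letter did not change, nothing was moved and both sides are the same word.
    refine wordLT_of_letterLT (permLT_give fun e => hne ?_)
    have hc : carry a b = 1 := by simpa [give_eq, pmul_eq_mul] using e
    simp [take_eq, give_eq, hc, pmul_eq_mul]
  | flip a =>
    by_cases ha : a = 1
    · subst ha
      have h1 : BraidGS.flip (1 : Equiv.Perm (Fin n)) = 1 := by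
        ext; simp [BraidGS.flip, pmul_apply, omega_apply]
      exact absurd (by simp [h1, wordR_one]) hne
    by_cases hf : BraidGS.flip a = 1
    · apply wordLT_of_length_lt
      simp [wordR_of_ne ha, hf, wordR_one, wordOmegaInv]
    rw [wordR_of_ne ha, wordR_of_ne hf]
    exact wordLT_of_letterLT trivial
  | omega_mul_inv =>
    apply wordLT_of_length_lt
    simp [wordR_one, wordOmegaInv]
  | inv_mul_omega =>
    apply wordLT_of_length_lt
    simp [wordR_one, wordOmegaInv]

end Order

/-! ### Triviality of compositions from uniqueness of irreducible words -/

section Compositions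

variable {n : ℕ} {k : Type*} [Field k]

theorem coeff_monom (u v : FreeMonoid (Letter n)) [Decidable (u = v)] :
    (monom k u).coeff v = if u = v then 1 else 0 := by
  simp [monom, Finsupp.single_apply]

theorem monom_mul (u v : FreeMonoid (Letter n)) : monom k (u * v) = monom k u * monom k v := by
  simp [monom]

theorem isLeadingWord_sub {u v : FreeMonoid (Letter n)} (h : WordLT v u) :
    IsLeadingWord WordLT (monom k u - monom k v) u ∧ (monom k u - monom k v).coeff u = 1 := by
  classical
  have hne : v ≠ u := by
    rintro rfl
    exact isMonomialOrder_wordLT.isStrictTotalOrder.irrefl _ h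
  have h1 : (monom k u - monom k v).coeff u = 1 := by
    rw [MonoidAlgebra.coeff_sub, Finsupp.sub_apply, coeff_monom, coeff_monom]
    simp [hne]
  refine ⟨⟨by rw [h1]; exact one_ne_zero, fun w hw hwu => ?_⟩, h1⟩
  rw [MonoidAlgebra.coeff_sub, Finsupp.sub_apply, coeff_monom, coeff_monom] at hw
  by_cases hv : v = w
  · exact hv ▸ h
  · simp [hv, hwu.symm] at hw

theorem IsLeadingWord.unique {f : MonoidAlgebra k (FreeMonoid (Letter n))}
    {u v : FreeMonoid (Letter n)} (hu : IsLeadingWord WordLT f u)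
    (hv : IsLeadingWord WordLT f v) : u = v := by
  by_contra hne
  have hasymm := isMonomialOrder_wordLT (n := n).isStrictTotalOrder
  exact hasymm.irrefl _ (hasymm.trans _ _ _ (hu.2 v hv.1 (Ne.symm hne)) (hv.2 u hu.1 hne))

theorem TrivialMod.trans {S : Set (MonoidAlgebra k (FreeMonoid (Letter n)))}
    {x y z w : FreeMonoid (Letter n)} (h : TrivialMod WordLT S (monom k x - monom k y) w)
    (h' : TrivialMod WordLT S (monom k y - monom k z) w) :
    TrivialMod WordLT S (monom k x - monom k z) w := by
  have := Submodule.add_mem _ h h'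
  rwa [sub_add_sub_cancel] at this

theorem TrivialMod.symm {S : Set (MonoidAlgebra k (FreeMonoid (Letter n)))}
    {x y w : FreeMonoid (Letter n)} (h : TrivialMod WordLT S (monom k x - monom k y) w) :
    TrivialMod WordLT S (monom k y - monom k x) w := by
  have := Submodule.neg_mem _ h
  rwa [neg_sub] at this

theorem Rel.trivialMod {u v : FreeMonoid (Letter n)} (h : Rel n u v) (hne : u ≠ v)
    {a b w : FreeMonoid (Letter n)} (hw : WordLT (a * u * b) w) :
    TrivialMod WordLT (relPolys n k) (monom k (a * u * b) - monom k (a * v * b)) w := by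
  refine Submodule.subset_span ⟨monom k u - monom k v, ⟨u, v, h, hne, rfl⟩, u, a, b,
    (isLeadingWord_sub (h.wordLT hne)).1, hw, ?_⟩
  simp only [monom_mul, mul_sub, sub_mul]

variable (k) in
-- Each rewriting step subtracts one `a s b` whose leading word is the current word. The words only
-- decrease, so a single reduction serves every `w` above `x`.
theorem exists_irreducibleWord (x : FreeMonoid (Letter n)) :
    ∃ z, IrreducibleWord z ∧ conGen (Rel n) x z ∧ ∀ w, WordLT x w →
      TrivialMod WordLT (relPolys n k) (monom k x - monom k z) w := by
  induction x using isMonomialOrder_wordLT.wellFounded.induction with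
  | _ x ih =>
    by_cases hx : IrreducibleWord x
    · refine ⟨x, hx, (conGen (Rel n)).refl x, fun w _ => ?_⟩
      rw [sub_self]
      exact Submodule.zero_mem _
    · simp only [IrreducibleWord, not_forall] at hx
      obtain ⟨p, q, u, v, rfl, huv, hne⟩ := hx
      have hlt : WordLT (p * v * q) (p * u * q) :=
        isMonomialOrder_wordLT.mul_lt_mul _ _ _ _ (huv.wordLT hne)
      obtain ⟨z, hz, hcon, htriv⟩ := ih _ hlt
      refine ⟨z, hz, (conGen (Rel n)).trans ?_ hcon, fun w hw => ?_⟩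
      · exact (conGen (Rel n)).mul ((conGen (Rel n)).mul ((conGen (Rel n)).refl p)
          (ConGen.Rel.of _ _ huv)) ((conGen (Rel n)).refl q)
      · exact (huv.trivialMod hne hw).trans
          (htriv w (isMonomialOrder_wordLT.isStrictTotalOrder.trans _ _ _ hlt hw))

theorem trivialMod_of_conGen (hn : omega n ≠ 1) {x y w : FreeMonoid (Letter n)}
    (h : conGen (Rel n) x y) (hx : WordLT x w) (hy : WordLT y w) :
    TrivialMod WordLT (relPolys n k) (monom k x - monom k y) w := by
  obtain ⟨z, hz, hxz, htx⟩ := exists_irreducibleWord k x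
  obtain ⟨z', hz', hyz', hty⟩ := exists_irreducibleWord k y
  obtain rfl : z = z' := hz.eq_of_conGen hn hz'
    ((conGen (Rel n)).trans ((conGen (Rel n)).symm hxz) ((conGen (Rel n)).trans h hyz'))
  exact (htx w hx).trans (hty w hy).symm

theorem isGroebnerShirshov_relPolys (hn : omega n ≠ 1) :
    IsGroebnerShirshov WordLT (relPolys n k) where
  monomialOrder := isMonomialOrder_wordLT
  monic := by
    rintro _ ⟨u, v, h, hne, rfl⟩
    exact ⟨u, isLeadingWord_sub (h.wordLT hne)⟩
  intersection := by
    rintro _ ⟨u, v, h, hne, rfl⟩ _ ⟨u', v', h', hne', rfl⟩ u₁ u₁' a b hu hu' hab _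
    obtain rfl := hu.unique (isLeadingWord_sub (h.wordLT hne)).1
    obtain rfl := hu'.unique (isLeadingWord_sub (h'.wordLT hne')).1
    have hlt := isMonomialOrder_wordLT.mul_lt_mul 1 b _ _ (h.wordLT hne)
    have hlt' := isMonomialOrder_wordLT.mul_lt_mul a 1 _ _ (h'.wordLT hne')
    rw [one_mul, one_mul] at hlt
    rw [mul_one, mul_one, ← hab] at hlt'
    -- Both words arise by one rewriting of the overlap word `u₁ * b = a * u₁'`.
    have hcon : conGen (Rel n) (a * v') (v * b) := by
      refine (conGen (Rel n)).trans ((conGen (Rel n)).symm ((conGen (Rel n)).mul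
        ((conGen (Rel n)).refl a) (ConGen.Rel.of _ _ h'))) ?_
      rw [← hab]
      exact (conGen (Rel n)).mul (ConGen.Rel.of _ _ h) ((conGen (Rel n)).refl b)
    have key := trivialMod_of_conGen (k := k) hn hcon hlt' hlt
    have heq : (monom k u₁ - monom k v) * monom k b - monom k a * (monom k u₁' - monom k v') =
        monom k (a * v') - monom k (v * b) := by
      rw [sub_mul, mul_sub, ← monom_mul, ← monom_mul, ← monom_mul, ← monom_mul, hab]
      abel
    rwa [heq]
  inclusion := by
    rintro _ ⟨u, v, h, hne, rfl⟩ _ ⟨u', v', h', hne', rfl⟩ u₁ u₁' a b hu hu' hab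
    obtain rfl := hu.unique (isLeadingWord_sub (h.wordLT hne)).1
    obtain rfl := hu'.unique (isLeadingWord_sub (h'.wordLT hne')).1
    have hlt := h.wordLT hne
    have hlt' := isMonomialOrder_wordLT.mul_lt_mul a b _ _ (h'.wordLT hne')
    rw [← hab] at hlt'
    have hcon : conGen (Rel n) (a * v' * b) v := by
      refine (conGen (Rel n)).trans ((conGen (Rel n)).symm ((conGen (Rel n)).mul
        ((conGen (Rel n)).mul ((conGen (Rel n)).refl a) (ConGen.Rel.of _ _ h'))
        ((conGen (Rel n)).refl b))) ?_
      rw [← hab]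
      exact ConGen.Rel.of _ _ h
    have key := trivialMod_of_conGen (k := k) hn hcon hlt' hlt
    have heq : monom k u₁ - monom k v - monom k a * (monom k u₁' - monom k v') * monom k b =
        monom k (a * v' * b) - monom k v := by
      rw [mul_sub, sub_mul, ← monom_mul, ← monom_mul, ← monom_mul, ← monom_mul, ← hab]
      abel
    rwa [heq]

end Compositions

/-! ### Matsumoto's theorem: reduced words of a permutation represent one braid -/

section Matsumoto

variable {n : ℕ}

/-- The transposition of the `i`-th generator. -/
def transp (i : Fin (n - 1)) : Equiv.Perm (Fin n) := Equiv.swap (lo i) (hi i)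

theorem lo_lt_hi (i : Fin (n - 1)) : lo i < hi i := by simp [lo, hi, Fin.lt_def]

theorem transp_apply_transp (i : Fin (n - 1)) (x : Fin n) : transp i (transp i x) = x := by
  simp [transp]

theorem transp_lo (i : Fin (n - 1)) : transp i (lo i) = hi i := Equiv.swap_apply_left _ _

theorem transp_hi (i : Fin (n - 1)) : transp i (hi i) = lo i := Equiv.swap_apply_right _ _

theorem wordPerm_cons (i : Fin (n - 1)) (w : List (Fin (n - 1))) :
    wordPerm (i :: w) = pmul (transp i) (wordPerm w) := rfl

theorem wordPerm_nil : wordPerm ([] : List (Fin (n - 1))) = 1 := rfl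

theorem reduced_transp_iff {i : Fin (n - 1)} {a : Equiv.Perm (Fin n)} :
    Reduced (transp i) a ↔ a (lo i) < a (hi i) := by
  rw [reduced_iff]
  constructor
  · intro h
    simpa [transp_lo, transp_hi] using h (lo i) (hi i) (lo_lt_hi i)
      (by simpa [transp_lo, transp_hi] using lo_lt_hi i)
  · intro h x y hxy hyx
    by_cases he : s(x, y) = s(lo i, hi i)
    · rcases Sym2.eq_iff.1 he with ⟨rfl, rfl⟩ | ⟨rfl, rfl⟩
      · simpa [transp_lo, transp_hi] using h
      · exact absurd hxy (lt_asymm (lo_lt_hi i))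
    · exact absurd hyx (lt_asymm (swap_lt_swap i x y hxy he))

/-- Each letter of the word creates a new inversion. -/
def ReducedWord : List (Fin (n - 1)) → Prop
  | [] => True
  | i :: w => Reduced (transp i) (wordPerm w) ∧ ReducedWord w

/-- Two strands that never cross keep their order. In a non-repeating word, the strands crossed by
the first letter do not cross again, so that letter creates an inversion. -/
theorem lt_of_notMem_crossings (w : List (Fin (n - 1))) : ∀ x y, x < y →
    s(x, y) ∉ crossings w → wordPerm w x < wordPerm w y := by
  induction w with
  | nil => intro x y h _; exact h
  | cons i w ih =>
    intro x y hxy h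
    simp only [crossings, List.mem_cons, not_or] at h
    refine ih _ _ (swap_lt_swap i x y hxy h.1) fun hmem => h.2 ?_
    refine List.mem_map.2 ⟨_, hmem, ?_⟩
    simp

theorem NonRepeating.reducedWord {w : List (Fin (n - 1))} (h : NonRepeating w) :
    ReducedWord w := by
  induction w with
  | nil => trivial
  | cons i w ih =>
    have h' := List.nodup_cons.1 h
    refine ⟨reduced_transp_iff.2 (lt_of_notMem_crossings w _ _ (lo_lt_hi i) fun hmem => h'.1 ?_),
      ih (List.Nodup.of_map _ h'.2)⟩
    refine List.mem_map.2 ⟨_, hmem, ?_⟩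
    simp [Sym2.eq_swap]

theorem exists_reducedWord (a : Equiv.Perm (Fin n)) :
    ∃ w : List (Fin (n - 1)), ReducedWord w ∧ wordPerm w = a := by
  obtain ⟨w, h1, h2, _⟩ := exists_nonRepeating_aux _ a rfl
  exact ⟨w, h1.reducedWord, h2⟩

theorem wordPerm_append (w w' : List (Fin (n - 1))) :
    wordPerm (w ++ w') = pmul (wordPerm w) (wordPerm w') := by
  induction w with
  | nil => rfl
  | cons i w ih => rw [List.cons_append, wordPerm_cons, ih, wordPerm_cons]; rfl

/-- Length-additivity of a triple product. -/
theorem Reduced.of_pmul_left {a b c : Equiv.Perm (Fin n)} (hab : Reduced a b)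
    (h : Reduced (pmul a b) c) : Reduced b c ∧ Reduced a (pmul b c) := by
  refine ⟨?_, hab.trans h⟩
  rw [reduced_iff] at *
  intro i j hij hji
  have h2 : a⁻¹ i < a⁻¹ j := by
    by_contra hn
    have hlt : a⁻¹ j < a⁻¹ i := lt_of_le_of_ne (not_lt.1 hn) fun e => hij.ne' (a⁻¹.injective e)
    have := hab _ _ hlt (by simpa using hij)
    simp only [Equiv.Perm.inv_def, Equiv.apply_symm_apply] at this
    exact lt_asymm this hji
  simpa [pmul_apply] using h _ _ h2 (by simpa [pmul_apply] using hji)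

theorem ReducedWord.append {w w' : List (Fin (n - 1))} (hw : ReducedWord w)
    (hw' : ReducedWord w') (h : Reduced (wordPerm w) (wordPerm w')) : ReducedWord (w ++ w') := by
  induction w with
  | nil => exact hw'
  | cons i w ih =>
    obtain ⟨h1, h2⟩ := Reduced.of_pmul_left hw.1 h
    refine ⟨?_, ih hw.2 h1⟩
    change Reduced _ (wordPerm (w ++ w'))
    rwa [wordPerm_append]

theorem braidOf_append (w w' : List (Fin (n - 1))) :
    braidOf (w ++ w') = braidOf w * braidOf w' := by simp [braidOf]

theorem braidOf_comm {i j : Fin (n - 1)} (h : i.1 + 1 < j.1) :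
    (braidOf [i, j] : BraidGroup n) = braidOf [j, i] := by
  have : PresentedGroup.mk (braidRels n) _ = 1 :=
    PresentedGroup.one_of_mem (Or.inl ⟨i, j, h, rfl⟩)
  rw [map_mul, map_inv, mul_inv_eq_one] at this
  simpa [braidOf, PresentedGroup.of] using this

theorem braidOf_braid {i j : Fin (n - 1)} (h : i.1 + 1 = j.1) :
    (braidOf [i, j, i] : BraidGroup n) = braidOf [j, i, j] := by
  have : PresentedGroup.mk (braidRels n) _ = 1 :=
    PresentedGroup.one_of_mem (Or.inr ⟨i, j, h, rfl⟩)
  rw [map_mul, map_inv, mul_inv_eq_one] at this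
  simpa [braidOf, PresentedGroup.of, mul_assoc] using this

theorem wordPerm_comm {i j : Fin (n - 1)} (h : i.1 + 1 < j.1) :
    wordPerm [i, j] = (wordPerm [j, i] : Equiv.Perm (Fin n)) := by
  ext x
  simp only [wordPerm, pmul_apply, Equiv.swap_apply_def, Fin.ext_iff, lo, hi,
    Equiv.Perm.one_apply]
  split_ifs <;> (try dsimp only at *) <;> omega

theorem wordPerm_braid {i j : Fin (n - 1)} (h : i.1 + 1 = j.1) :
    wordPerm [i, j, i] = (wordPerm [j, i, j] : Equiv.Perm (Fin n)) := by
  have hq : lo j = hi i := (Fin.ext h).symm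
  have h1 : hi j ≠ hi i := by simp only [ne_eq, Fin.ext_iff, hi]; omega
  have h2 : hi j ≠ lo i := by simp only [ne_eq, Fin.ext_iff, lo, hi]; omega
  have e1 := Equiv.swap_mul_swap_mul_swap h1 h2
  have e2 := Equiv.swap_mul_swap_mul_swap (lo_lt_hi i).ne h2.symm
  simp only [wordPerm, pmul_eq_mul, one_mul, hq]
  rw [Equiv.swap_comm (lo i) (hi i), Equiv.swap_comm (hi i) (hi j), e1,
    Equiv.swap_comm (hi j) (hi i), Equiv.swap_comm (hi i) (lo i), e2, Equiv.swap_comm]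

theorem reducedWord_comm {i j : Fin (n - 1)} (h : i.1 + 1 < j.1 ∨ j.1 + 1 < i.1)
    {w : List (Fin (n - 1))} (hw : ReducedWord w) (hi' : wordPerm w (lo i) < wordPerm w (hi i))
    (hj : wordPerm w (lo j) < wordPerm w (hi j)) : ReducedWord (i :: j :: w) := by
  refine ⟨reduced_transp_iff.2 ?_, reduced_transp_iff.2 hj, hw⟩
  have h1 : transp j (lo i) = lo i := by
    apply Equiv.swap_apply_of_ne_of_ne <;> simp only [ne_eq, Fin.ext_iff, lo, hi] <;> omega
  have h2 : transp j (hi i) = hi i := by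
    apply Equiv.swap_apply_of_ne_of_ne <;> simp only [ne_eq, Fin.ext_iff, lo, hi] <;> omega
  rwa [wordPerm_cons, pmul_apply, pmul_apply, h1, h2]

theorem hi_eq_lo {i j : Fin (n - 1)} (h : i.1 + 1 = j.1) : hi i = lo j := Fin.ext h

theorem transp_hi_succ {i j : Fin (n - 1)} (h : i.1 + 1 = j.1) : transp i (hi j) = hi j := by
  apply Equiv.swap_apply_of_ne_of_ne <;> simp only [ne_eq, Fin.ext_iff, lo, hi] <;> omega

theorem transp_lo_pred {i j : Fin (n - 1)} (h : i.1 + 1 = j.1) : transp j (lo i) = lo i := by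
  apply Equiv.swap_apply_of_ne_of_ne <;> simp only [ne_eq, Fin.ext_iff, lo, hi] <;> omega

theorem transp_hi_pred {i j : Fin (n - 1)} (h : i.1 + 1 = j.1) : transp j (hi i) = hi j := by
  rw [hi_eq_lo h, transp_lo]

theorem transp_lo_succ {i j : Fin (n - 1)} (h : i.1 + 1 = j.1) : transp i (lo j) = lo i := by
  rw [← hi_eq_lo h, transp_hi]

/-- `wordPerm w` increases on three consecutive positions, and each side of the braid relation
crosses every pair of them exactly once. -/
theorem reducedWord_braid {i j : Fin (n - 1)} (h : i.1 + 1 = j.1)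
    {w : List (Fin (n - 1))} (hw : ReducedWord w) (hi' : wordPerm w (lo i) < wordPerm w (hi i))
    (hj : wordPerm w (lo j) < wordPerm w (hi j)) :
    ReducedWord (i :: j :: i :: w) ∧ ReducedWord (j :: i :: j :: w) := by
  have hp := hi'.trans ((congrArg (wordPerm w) (hi_eq_lo h)).trans_lt hj)
  refine ⟨⟨reduced_transp_iff.2 ?_, reduced_transp_iff.2 ?_, reduced_transp_iff.2 hi', hw⟩,
    ⟨reduced_transp_iff.2 ?_, reduced_transp_iff.2 ?_, reduced_transp_iff.2 hj, hw⟩⟩ <;>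
    simp only [wordPerm_cons, pmul_apply, transp_lo, transp_hi, transp_hi_succ h,
      transp_lo_pred h, transp_hi_pred h, transp_lo_succ h]
  · rwa [hi_eq_lo h]
  · exact hp
  · rwa [← hi_eq_lo h]
  · exact hp

/-- The common continuation of two reduced words with different first letters. -/
theorem exists_reducedWord_of_descents {i j : Fin (n - 1)} (hij : i < j)
    {a : Equiv.Perm (Fin n)} (hai : a (hi i) < a (lo i)) (haj : a (hi j) < a (lo j)) :
    ∃ u v : List (Fin (n - 1)), ReducedWord (i :: u) ∧ ReducedWord (j :: v) ∧
      wordPerm (i :: u) = a ∧ wordPerm (j :: v) = a ∧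
      (braidOf (i :: u) : BraidGroup n) = braidOf (j :: v) := by
  -- The generators are far apart or adjacent. In either case the local longest element, `σ_i σ_j`
  -- or `σ_i σ_j σ_i`, is split off from `a`.
  rcases (Nat.succ_le_of_lt (Fin.lt_def.1 hij)).lt_or_eq with h | h
  · obtain ⟨w, hw, hwa⟩ := exists_reducedWord (pmul (wordPerm [j, i]) a)
    have h1 : transp j (lo i) = lo i := by
      apply Equiv.swap_apply_of_ne_of_ne <;> simp only [ne_eq, Fin.ext_iff, lo, hi] <;> omega
    have h2 : transp j (hi i) = hi i := by
      apply Equiv.swap_apply_of_ne_of_ne <;> simp only [ne_eq, Fin.ext_iff, lo, hi] <;> omega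
    have h3 : transp i (lo j) = lo j := by
      apply Equiv.swap_apply_of_ne_of_ne <;> simp only [ne_eq, Fin.ext_iff, lo, hi] <;> omega
    have h4 : transp i (hi j) = hi j := by
      apply Equiv.swap_apply_of_ne_of_ne <;> simp only [ne_eq, Fin.ext_iff, lo, hi] <;> omega
    have hwi : wordPerm w (lo i) < wordPerm w (hi i) := by
      simpa [hwa, wordPerm_cons, pmul_apply, h1, h2, transp_lo, transp_hi, wordPerm_nil] using hai
    have hwj : wordPerm w (lo j) < wordPerm w (hi j) := by
      simpa [hwa, wordPerm_cons, pmul_apply, h3, h4, transp_lo, transp_hi, wordPerm_nil] using haj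
    have hperm : wordPerm ([i, j] ++ w) = a := by
      rw [wordPerm_append, hwa]
      ext x
      simp [wordPerm_cons, pmul_apply, transp_apply_transp, wordPerm_nil]
    refine ⟨j :: w, i :: w, reducedWord_comm (Or.inl h) hw hwi hwj,
      reducedWord_comm (Or.inr h) hw hwj hwi, hperm, ?_, ?_⟩
    · rw [← hperm, wordPerm_append, wordPerm_comm h, ← wordPerm_append]; rfl
    · change braidOf ([i, j] ++ w) = braidOf ([j, i] ++ w)
      rw [braidOf_append, braidOf_append, braidOf_comm h]
  · change i.1 + 1 = j.1 at h
    obtain ⟨w, hw, hwa⟩ := exists_reducedWord (pmul (wordPerm [i, j, i]) a)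
    have hperm : wordPerm ([i, j, i] ++ w) = a := by
      rw [wordPerm_append, hwa]
      ext x
      simp [wordPerm_cons, pmul_apply, transp_apply_transp, wordPerm_nil]
    -- Reversing three positions exchanges their two adjacent pairs, so the descent of `a` at `j`
    -- gives the ascent of `w` at `i`, and conversely.
    have hwi : wordPerm w (lo i) < wordPerm w (hi i) := by
      simpa [hwa, wordPerm_cons, pmul_apply, transp_lo, transp_hi, wordPerm_nil, transp_hi_succ h,
        transp_lo_pred h, transp_hi_pred h, transp_lo_succ h, hi_eq_lo h] using haj
    have hwj : wordPerm w (lo j) < wordPerm w (hi j) := by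
      simpa [hwa, wordPerm_cons, pmul_apply, transp_lo, transp_hi, wordPerm_nil, transp_hi_succ h,
        transp_lo_pred h, transp_hi_pred h, transp_lo_succ h, ← hi_eq_lo h] using hai
    obtain ⟨hr1, hr2⟩ := reducedWord_braid h hw hwi hwj
    refine ⟨_, _, hr1, hr2, hperm, ?_, ?_⟩
    · rw [← hperm, wordPerm_append, wordPerm_braid h, ← wordPerm_append]; rfl
    · change braidOf ([i, j, i] ++ w) = braidOf ([j, i, j] ++ w)
      rw [braidOf_append, braidOf_append, braidOf_braid h]

/-- For inverses, prefixing a letter is a plain inclusion of inversion sets; for the permutations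
themselves the pairs would have to be relabelled. -/
theorem card_inversions_inv_lt {i : Fin (n - 1)} {a : Equiv.Perm (Fin n)}
    (h : Reduced (transp i) a) :
    (inversions a⁻¹).card < (inversions (pmul (transp i) a)⁻¹).card := by
  refine Finset.card_lt_card (Finset.ssubset_iff_subset_ne.2 ⟨reduced_inv_inv.2 h, fun e => ?_⟩)
  have h1 := congrArg (fun b => b (lo i)) (inv_injective (inversions_injective e))
  exact (lo_lt_hi i).ne (a.injective (h1.trans (by simp [pmul_apply, transp_lo])))

/-- Two reduced words with the same permutation represent the same braid. -/
theorem braidOf_eq_of_reducedWord (m : ℕ) : ∀ w w' : List (Fin (n - 1)), ReducedWord w →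
    ReducedWord w' → wordPerm w = wordPerm w' → (inversions (wordPerm w)⁻¹).card = m →
    (braidOf w : BraidGroup n) = braidOf w' := by
  induction m using Nat.strong_induction_on with
  | _ m ih =>
    have hdesc : ∀ (i : Fin (n - 1)) (t : List (Fin (n - 1))), ReducedWord (i :: t) →
        wordPerm (i :: t) (hi i) < wordPerm (i :: t) (lo i) := by
      intro i t h
      simpa [wordPerm_cons, pmul_apply, transp_lo, transp_hi] using reduced_transp_iff.1 h.1
    have hnil : ∀ (i : Fin (n - 1)) (t : List (Fin (n - 1))), ReducedWord (i :: t) →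
        wordPerm (i :: t) ≠ 1 := by
      intro i t h he
      have := hdesc i t h
      rw [he] at this
      exact lt_asymm this (lo_lt_hi i)
    have hcons : ∀ (i : Fin (n - 1)) (t t' : List (Fin (n - 1))), ReducedWord (i :: t) →
        ReducedWord (i :: t') → wordPerm (i :: t) = wordPerm (i :: t') →
        (inversions (wordPerm (i :: t))⁻¹).card = m →
        (braidOf (i :: t) : BraidGroup n) = braidOf (i :: t') := by
      intro i t t' h h' he hm
      have he' : wordPerm t = wordPerm t' := by
        simpa [wordPerm_cons, pmul_eq_mul] using he
      have := ih _ (hm ▸ card_inversions_inv_lt h.1) t t' h.2 h'.2 he' rfl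
      change braidOf ([i] ++ t) = braidOf ([i] ++ t')
      rw [braidOf_append, braidOf_append, this]
    intro w w' hw hw' he hm
    cases w with
    | nil =>
      cases w' with
      | nil => rfl
      | cons j t' => exact absurd he.symm (hnil j t' hw')
    | cons i t =>
      cases w' with
      | nil => exact absurd he (hnil i t hw)
      | cons j t' =>
        have hdi := hdesc i t hw
        have hdj := hdesc j t' hw'
        rw [← he] at hdj
        rcases lt_trichotomy i j with hij | rfl | hij
        -- The words `i :: u` and `j :: v` bridge the two given words: each shares its first letter
        -- with one of them, so the induction applies to the tails.
        · obtain ⟨u, v, hu, hv, hua, hva, huv⟩ := exists_reducedWord_of_descents hij hdi hdj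
          rw [hcons i t u hw hu hua.symm hm, huv, hcons j v t' hv hw' (hva.trans he) (hva ▸ hm)]
        · exact hcons i t t' hw hw' he hm
        · obtain ⟨v, u, hv, hu, hva, hua, huv⟩ := exists_reducedWord_of_descents hij hdj hdi
          rw [hcons i t u hw hu hua.symm hm, ← huv, hcons j v t' hv hw' (hva.trans he) (hva ▸ hm)]

theorem ReducedWord.thurston_eq {w : List (Fin (n - 1))} (hw : ReducedWord w) :
    thurston (wordPerm w) = braidOf w := by
  obtain ⟨w', h1, h2, h3⟩ := thurston_spec (wordPerm w)
  rw [← h3]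
  exact braidOf_eq_of_reducedWord _ _ _ h1.reducedWord hw h2 rfl

theorem thurston_mul {a b : Equiv.Perm (Fin n)} (h : Reduced a b) :
    thurston a * thurston b = thurston (pmul a b) := by
  obtain ⟨u, hu, rfl⟩ := exists_reducedWord a
  obtain ⟨v, hv, rfl⟩ := exists_reducedWord b
  rw [← wordPerm_append, (hu.append hv h).thurston_eq, hu.thurston_eq, hv.thurston_eq,
    braidOf_append]

theorem thurston_one : thurston (1 : Equiv.Perm (Fin n)) = 1 :=
  ReducedWord.thurston_eq (w := []) trivial

theorem thurston_transp (i : Fin (n - 1)) : thurston (transp i) = PresentedGroup.of i := by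
  have h : ReducedWord [i] := ⟨reduced_one_right _, trivial⟩
  have := h.thurston_eq
  simpa [braidOf, wordPerm_cons, wordPerm_nil, pmul_eq_mul] using this

/-- A multiplicative family on permutations is computed by reduced words. -/
theorem ReducedWord.prod_map {N : Type*} [Monoid N] {f : Equiv.Perm (Fin n) → N}
    (hmul : ∀ a b, Reduced a b → f a * f b = f (pmul a b)) (hone : f 1 = 1)
    {w : List (Fin (n - 1))} (hw : ReducedWord w) :
    (w.map fun i => f (transp i)).prod = f (wordPerm w) := by
  induction w with
  | nil => exact hone.symm
  | cons i w ih => rw [List.map_cons, List.prod_cons, ih hw.2, hmul _ _ hw.1, wordPerm_cons]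

end Matsumoto

/-! ### The relations present the braid group -/

section Presentation

variable {n : ℕ}

/-- The braid of a positive braid. -/
noncomputable def positiveToBraid : PositiveMonoid n →* BraidGroup n :=
  PositiveMonoid.lift thurston (fun _ _ => thurston_mul) thurston_one

theorem positiveToBraid_simple (a : Equiv.Perm (Fin n)) :
    positiveToBraid (PositiveMonoid.simple a) = thurston a :=
  PositiveMonoid.lift_simple _ _ _ a

theorem wordVal_wordR (a : Equiv.Perm (Fin n)) : wordVal n (wordR a) = thurston a := by
  by_cases ha : a = 1
  · rw [ha, wordR_one, map_one, thurston_one]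
  · rw [wordR_of_ne ha, wordVal, FreeMonoid.lift_eval_of]; rfl

theorem wordVal_wordOmegaInv : wordVal n (wordOmegaInv n) = (thurston (omega n))⁻¹ := by
  rw [wordOmegaInv, wordVal, FreeMonoid.lift_eval_of]; rfl

theorem conGen_rel_le_ker : conGen (Rel n) ≤ Con.ker (wordVal n) := by
  rw [Con.conGen_le]
  rintro _ _ (⟨a, b⟩ | a | _ | _) <;>
    simp only [Con.ker_rel, map_mul, wordVal_wordR, wordVal_wordOmegaInv, thurston_one]
  · simp only [← positiveToBraid_simple, ← map_mul, PositiveMonoid.simple_mul_simple_eq a b]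
  -- Clearing the inverses of `Ω` leaves an identity between positive braids.
  · rw [inv_mul_eq_iff_eq_mul, ← mul_assoc, eq_mul_inv_iff_mul_eq]
    simp only [← positiveToBraid_simple, ← map_mul]
    rw [PositiveMonoid.omega_mul_simple, PositiveMonoid.flip_flip]
  · simp
  · simp

/-- The monoid defined by the relations. -/
abbrev RelMonoid (n : ℕ) : Type := (conGen (Rel n)).Quotient

/-- The class of `R_a`. -/
noncomputable def relR (a : Equiv.Perm (Fin n)) : RelMonoid n := (conGen (Rel n)).mk' (wordR a)

/-- The class of `Ω⁻¹`. -/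
def relOmegaInv (n : ℕ) : RelMonoid n := (conGen (Rel n)).mk' (wordOmegaInv n)

theorem mk_eq_of_rel {u v : FreeMonoid (Letter n)} (h : Rel n u v) :
    (conGen (Rel n)).mk' u = (conGen (Rel n)).mk' v := (Con.eq _).2 (ConGen.Rel.of _ _ h)

theorem relR_one : relR (1 : Equiv.Perm (Fin n)) = 1 := by rw [relR, wordR_one, map_one]

theorem relR_mul {a b : Equiv.Perm (Fin n)} (h : Reduced a b) :
    relR a * relR b = relR (pmul a b) := by
  have := mk_eq_of_rel (Rel.mul a b)
  rwa [give_eq_one_of_reduced h, take_eq_of_reduced h, wordR_one, one_mul, map_mul] at this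

theorem relR_omega_mul : relR (omega n) * relOmegaInv n = 1 := by
  have := mk_eq_of_rel (Rel.omega_mul_inv (n := n))
  rwa [map_mul, wordR_one, map_one] at this

theorem relOmegaInv_mul : relOmegaInv n * relR (omega n) = 1 := by
  have := mk_eq_of_rel (Rel.inv_mul_omega (n := n))
  rwa [map_mul, wordR_one, map_one] at this

theorem isUnit_relR (a : Equiv.Perm (Fin n)) : IsUnit (relR a) := by
  refine isUnit_iff_exists_and_exists.2
    ⟨⟨relR (pmul a⁻¹ (omega n)) * relOmegaInv n, ?_⟩,
      ⟨relOmegaInv n * relR (pmul (omega n) a⁻¹), ?_⟩⟩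
  · rw [← mul_assoc, relR_mul (reduced_inv_pmul_omega a)]
    simpa [pmul_eq_mul] using relR_omega_mul
  · rw [mul_assoc, relR_mul (reduced_omega_pmul_inv a)]
    simpa [pmul_eq_mul] using relOmegaInv_mul

theorem prod_relR {w : List (Fin (n - 1))} (hw : ReducedWord w) :
    (w.map fun i => relR (transp i)).prod = relR (wordPerm w) :=
  hw.prod_map (fun _ _ => relR_mul) relR_one

/-- The homomorphism from the braid group to the units of the monoid defined by the relations. -/
noncomputable def braidToRel : BraidGroup n →* (RelMonoid n)ˣ :=
  PresentedGroup.toGroup (f := fun i => (isUnit_relR (transp i)).unit) (by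
    have hasc : ∀ i : Fin (n - 1), wordPerm ([] : List (Fin (n - 1))) (lo i) <
      wordPerm ([] : List (Fin (n - 1))) (hi i) := lo_lt_hi
    rintro _ (⟨i, j, h, rfl⟩ | ⟨i, j, h, rfl⟩)
    -- Both sides of an Artin relation are reduced words with the same permutation, so both have the
    -- value `relR` of it.
    · have h1 := prod_relR (reducedWord_comm (w := []) (Or.inl h) trivial (hasc i) (hasc j))
      have h2 := prod_relR (reducedWord_comm (w := []) (Or.inr h) trivial (hasc j) (hasc i))
      rw [wordPerm_comm h, ← h2] at h1
      rw [map_mul, map_inv, mul_inv_eq_one]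
      ext
      simpa using h1
    · obtain ⟨hr1, hr2⟩ := reducedWord_braid (w := []) h trivial (hasc i) (hasc j)
      have h1 := prod_relR hr1
      rw [wordPerm_braid h, ← prod_relR hr2] at h1
      rw [map_mul, map_inv, mul_inv_eq_one]
      ext
      simpa [mul_assoc] using h1)

theorem braidToRel_thurston (a : Equiv.Perm (Fin n)) :
    (braidToRel (thurston a) : RelMonoid n) = relR a := by
  obtain ⟨w, hw, rfl⟩ := exists_reducedWord a
  rw [hw.thurston_eq, ← prod_relR hw, braidOf]
  induction w with
  | nil => simp
  | cons i w ih =>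
    rw [List.map_cons, List.prod_cons, map_mul, Units.val_mul, ih hw.2, List.map_cons,
      List.prod_cons]
    congr 1
    simp [braidToRel]

/-- The class of a word is recovered from its braid, so words with the same braid are congruent. -/
theorem braidToRel_wordVal (w : FreeMonoid (Letter n)) :
    (braidToRel (wordVal n w) : RelMonoid n) = (conGen (Rel n)).mk' w := by
  induction w using FreeMonoid.inductionOn' with
  | one => simp
  | of_mul x w ih =>
    rw [map_mul, map_mul, Units.val_mul, ih, map_mul]
    congr 1
    cases x with
    | R a ha =>
      rw [← wordR_of_ne ha, wordVal_wordR, braidToRel_thurston]; rfl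
    | OmegaInv =>
      change (braidToRel (wordVal n (wordOmegaInv n)) : RelMonoid n) = relOmegaInv n
      rw [wordVal_wordOmegaInv, map_inv]
      exact Units.inv_eq_of_mul_eq_one_right (by rw [braidToRel_thurston, relR_omega_mul])

theorem ker_wordVal : Con.ker (wordVal n) ≤ conGen (Rel n) := by
  intro u v h
  have h' : wordVal n u = wordVal n v := h
  refine (Con.eq _).1 ?_
  change (conGen (Rel n)).mk' u = (conGen (Rel n)).mk' v
  rw [← braidToRel_wordVal, h', braidToRel_wordVal]

theorem conGen_rel_eq_ker : conGen (Rel n) = Con.ker (wordVal n) :=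
  le_antisymm conGen_rel_le_ker ker_wordVal

/-- It shows that the inverses of the Artin generators are products of letters, so `X` generates the
group already as a monoid. -/
theorem inv_thurston (a : Equiv.Perm (Fin n)) :
    (thurston a)⁻¹ = thurston (pmul a⁻¹ (omega n)) * (thurston (omega n))⁻¹ := by
  rw [inv_eq_iff_mul_eq_one, ← mul_assoc, thurston_mul (reduced_inv_pmul_omega a)]
  simp [pmul_eq_mul]

theorem wordVal_surjective : Function.Surjective (wordVal n) := by
  rw [← MonoidHom.mrange_eq_top, eq_top_iff]
  have hR : ∀ a : Equiv.Perm (Fin n), thurston a ∈ MonoidHom.mrange (wordVal n) :=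
    fun a => ⟨wordR a, wordVal_wordR a⟩
  have hΩ : (thurston (omega n))⁻¹ ∈ MonoidHom.mrange (wordVal n) :=
    ⟨wordOmegaInv n, wordVal_wordOmegaInv⟩
  intro x _
  induction x using PresentedGroup.induction_on with
  | _ x =>
    induction x using FreeGroup.induction_on with
    | C1 => rw [map_one]; exact one_mem _
    | of i =>
      have := hR (transp i)
      rwa [thurston_transp] at this
    | inv_of i _ =>
      have := mul_mem (hR (pmul (transp i)⁻¹ (omega n))) hΩ
      rw [← inv_thurston, thurston_transp] at this
      rwa [map_inv]
    | mul x y hx hy => rw [map_mul]; exact mul_mem (hx trivial) (hy trivial)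

theorem omega_ne_one (hn : 2 ≤ n) : omega n ≠ 1 := by
  intro h
  have := congrArg Fin.val (Equiv.congr_fun h ⟨0, by omega⟩)
  simp [omega_apply] at this
  omega

end Presentation

end BraidGS

theorem mainTheorem3 (n : ℕ) (hn : 2 ≤ n) (k : Type*) [Field k] :
    Function.Surjective (BraidGS.wordVal n) ∧
    conGen (BraidGS.Rel n) = Con.ker (BraidGS.wordVal n) ∧
    BraidGS.IsGroebnerShirshov BraidGS.WordLT (BraidGS.relPolys n k) :=
  ⟨BraidGS.wordVal_surjective, BraidGS.conGen_rel_eq_ker,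
    BraidGS.isGroebnerShirshov_relPolys (BraidGS.omega_ne_one hn)⟩
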